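/- \textbf{Model.} Consider a system of $n\ge 3$ crash-prone processes, each executing a deterministic state machine and exchanging messages over reliable links (every message sent by a correct process to a correct process is eventually delivered). Time is discrete. The system is partially synchronous with a known bound $\Delta\ge 1$: every run has a global stabilization time $\mathsf{GST}$, unknown to the processes, after which messages take at most $\Delta$ units of time to be delivered and non-crashed processes compute without delay; before $\mathsf{GST}$, message delays and process speeds are arbitrary. Round number $k\geq 1$ is the time interval $[(k-1)\Delta,k\Delta)$. In the consensus task over a set of values with at least two elements, every process has a proposal (an \emph{initial configuration} assigns a proposal to every process) and may output a decision, subject to: every decision is the proposal of some process (Validity); no two decisions are different (Agreement); every correct process eventually decides (Termination). A protocol is \emph{$f$-resilient} if Validity, Agreement and Termination hold in all its runs with at most $f$ faulty processes. Given a set $E$ of processes, a run is \emph{$E$-faulty synchronous} if the processes in $E$ crash at the beginning of the first round and all others are correct, all messages sent during a round are delivered precisely at the beginning of the next round (simultaneous messages arriving in any order), and all local computations are instantaneous. A protocol is \emph{$e$-two-step} if for every set $E$ of exactly $e$ processes: \begin{enumerate} \item for every initial configuration $I$, there is an $E$-faulty synchronous run starting from $I$ in which some process decides by time $2\Delta$;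 and \item for every initial configuration $I$ in which all processes outside $E$ propose the same value, and for every process $p\notin E$, there is an $E$-faulty synchronous run starting from $I$ in which $p$ decides by time $2\Delta$. \end{enumerate} \textbf{Theorem.} Let $n\ge 3$ and $0\le e\le f$. There exists a protocol for $n$ processes that is an $f$-resilient and $e$-two-step implementation of the consensus task if and only if $n\ge\max\{2e+f,\;2f+1\}$. -/

import Mathlib

universe u

namespace TwoStepConsensus

/-- What a process does in one atomic step: its new state, at most one message for every
destination (a message may bundle any amount of data), and possibly a decision. -/
structure StepResult (n : ℕ) (V State Msg : Type u) where
  state : State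
  send : Fin n → Option Msg
  decision : Option V

/-- A (deterministic) message-passing protocol for `n` processes with proposals in `V`. In a step, a
process handles the list of messages that have just reached it, each tagged with its sender,
in order of arrival (the list may be empty). Steps are taken at the ticks of a discrete clock,
so that a process can implement timers by counting its own steps. -/
structure Protocol (n : ℕ) (V : Type u) where
  State : Type u
  Msg : Type u
  init : Fin n → V → State
  step : Fin n → State → List (Fin n × Msg) → StepResult n V State Msg

/-- A message in transit: its sender, the time at which it was sent, and its content. Together with
the destination, the first two fields identify a message uniquely. -/
structure Packet (n : ℕ) (Msg : Type u) where
  sender : Fin n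
  sentAt : ℕ
  msg : Msg

variable {n : ℕ} {V : Type u}

/-- A run of the protocol `P` in the partially synchronous crash-failure model with message delay
bound `Δ`. The times are natural numbers. -/
structure Run (P : Protocol n V) (Δ : ℕ) where
  /-- The initial configuration. -/
  proposal : Fin n → V
  /-- The time at which a process crashes; `⊤` if it never does. -/
  crash : Fin n → ℕ∞
  /-- The global stabilization time, not accessible to the protocol. -/
  gst : ℕ
  /-- Whether a process takes a step at a given time. -/
  active : Fin n → ℕ → Prop
  /-- The messages delivered to a process at a given time, in order of arrival. -/
  inbox : Fin n → ℕ → List (Packet n P.Msg)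
  /-- The state of a process just before its possible step at a given time. -/
  state : Fin n → ℕ → P.State
  /-- `sent p t q` is the message, if any, that `p` sends to `q` at time `t`. -/
  sent : Fin n → ℕ → Fin n → Option P.Msg
  /-- The decision, if any, that a process outputs at a given time. -/
  output : Fin n → ℕ → Option V
  state_zero : ∀ p, state p 0 = P.init p (proposal p)
  step_active : ∀ p t, active p t →
    (⟨state p (t + 1), sent p t, output p t⟩ : StepResult n V P.State P.Msg) =
      P.step p (state p t) ((inbox p t).map fun d => (d.sender, d.msg))
  step_idle : ∀ p t, ¬ active p t →
    state p (t + 1) = state p t ∧ sent p t = (fun _ => none) ∧ output p t = none ∧ inbox p t = []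
  /-- A crashed process takes no steps. -/
  active_lt_crash : ∀ p t, active p t → (t : ℕ∞) < crash p
  /-- Only messages sent earlier are delivered. -/
  inbox_sent : ∀ q t, ∀ d ∈ inbox q t, d.sentAt < t ∧ sent d.sender d.sentAt q = some d.msg
  /-- A message is delivered at most once. -/
  inbox_nodup : ∀ q t, (inbox q t).Nodup
  inbox_unique : ∀ q t t', ∀ d ∈ inbox q t, d ∈ inbox q t' → t = t'
  /-- Links between correct processes are reliable. -/
  reliable : ∀ p q s m, crash p = ⊤ → crash q = ⊤ → sent p s q = some m →
    ∃ t, (⟨p, s, m⟩ : Packet n P.Msg) ∈ inbox q t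
  /-- After `gst`, messages take at most `Δ` units of time. -/
  delay_le : ∀ q t, ∀ d ∈ inbox q t, t ≤ max d.sentAt gst + Δ
  /-- After `gst`, local computations are not delayed. -/
  prompt : ∀ p t, gst ≤ t → (t : ℕ∞) < crash p → active p t

namespace Run

variable {P : Protocol n V} {Δ : ℕ}

/-- A process is correct in a run if it never crashes; otherwise it is faulty. -/
def Correct (r : Run P Δ) (p : Fin n) : Prop := r.crash p = ⊤

/-- In the run `r`, process `p` decides `v` at time `t`. -/
def DecidesAt (r : Run P Δ) (p : Fin n) (v : V) (t : ℕ) : Prop := r.output p t = some v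

/-- Every decision is the proposal of some process. -/
def Validity (r : Run P Δ) : Prop :=
  ∀ p v t, r.DecidesAt p v t → ∃ q, r.proposal q = v

/-- No two decisions are different. -/
def Agreement (r : Run P Δ) : Prop :=
  ∀ p v t p' v' t', r.DecidesAt p v t → r.DecidesAt p' v' t' → v = v'

/-- Every correct process eventually decides. -/
def Termination (r : Run P Δ) : Prop :=
  ∀ p, r.Correct p → ∃ v t, r.DecidesAt p v t

/-- `E`-faulty synchronous runs. Round number `k`, counted from `0`, is the time interval
`[k * Δ, (k + 1) * Δ)`. -/
structure FaultySynchronous (r : Run P Δ) (E : Finset (Fin n)) : Prop where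
  /-- The processes outside `E` are correct. -/
  correct : ∀ p, p ∉ E → r.Correct p
  /-- The processes in `E` crash at the beginning of the first round. -/
  crashed : ∀ p, p ∈ E → r.crash p = 0
  /-- A message sent during a round is delivered precisely at the beginning of the next one. -/
  delivery : ∀ p q s m, q ∉ E → r.sent p s q = some m →
    (⟨p, s, m⟩ : Packet n P.Msg) ∈ r.inbox q ((s / Δ + 1) * Δ)
  /-- All local computations are instantaneous. -/
  instantaneous : ∀ p t, p ∉ E → r.active p t

/-- The run is two-step for `p`: process `p` decides a value by time `2 * Δ`. -/
def TwoStepFor (r : Run P Δ) (p : Fin n) : Prop :=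
  ∃ v t, t ≤ 2 * Δ ∧ r.DecidesAt p v t

end Run

namespace Protocol

/-- `P` achieves consensus in every run with at most `f` faulty processes. -/
def Resilient (P : Protocol n V) (Δ f : ℕ) : Prop :=
  ∀ r : Run P Δ, {p | ¬ r.Correct p}.ncard ≤ f → r.Validity ∧ r.Agreement ∧ r.Termination

/-- `P` is `e`-two-step (as an implementation of the consensus task). -/
def TwoStep (P : Protocol n V) (Δ e : ℕ) : Prop :=
  ∀ E : Finset (Fin n), E.card = e →
    (∀ I : Fin n → V, ∃ r : Run P Δ,
      r.proposal = I ∧ r.FaultySynchronous E ∧ ∃ p, r.TwoStepFor p) ∧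
    (∀ I : Fin n → V, (∃ v, ∀ p, p ∉ E → I p = v) →
      ∀ p, p ∉ E → ∃ r : Run P Δ,
        r.proposal = I ∧ r.FaultySynchronous E ∧ r.TwoStepFor p)

end Protocol

end TwoStepConsensus

/-! Necessity rests on indistinguishability: runs that deliver the same messages agree
(`Run.agree`), and `Schedule.hybrid` glues prefixes of given runs into a new one. If n ≤ 2f, two
halves of at most f processes each decide different values on their own while the messages between
them are delayed.

Now let 2f + 1 ≤ n < 2e + f. Take synchronous runs r and r' with disjoint crashed sets E and E' of
size e, in which p and p' decide by time 2Δ. Form two gluings: in both, E acts as in r' and E' as in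
r, while the remaining processes act as in r in one gluing and as in r' in the other. Everything
outside Q = (E ∪ E') \ {p} crashes right after time 2Δ. At least 2e - 1 ≥ n - f processes survive.
From the others they see only first-round messages, which depend on the proposals alone, so they
decide the same in both gluings, and the two fast decisions coincide (`fast_decisions_eq`). Starting
from a fast run in which everybody proposes v, this carries the decision v to runs with ever fewer
proposals v, and finally contradicts a run in which everybody proposes w ≠ v (`not_fast_decision`).

Sufficiency: `gossip` is Paxos preceded by a fast ballot 0, over an ordered set of values. In ballot
0 a process votes for the first proposal it receives that does not exceed its own, and n - e votes
decide. If the least proposal of a correct process arrives first everywhere, its proposer decides in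
two rounds (`exists_fast_run`). The leader of a later ballot collects the snapshots of n - f
processes. It adopts the value accepted in the highest ballot. If there is none, it adopts the least
value that has n - f - e votes in the quorum and whose proposer is outside the quorum. A value
decided in ballot 0 qualifies, and 2e + f ≤ n excludes a smaller one (`Proposed.eq_of_chosen`).
Ballots start at quadratically growing times, so some ballot eventually runs undisturbed
(`termination`). -/

namespace TwoStepConsensus

variable {n : ℕ} {V : Type u}

/-! ### Runs as delivery patterns, and indistinguishability -/

/-- The packets that reach `q` when the messages sent according to `sent` are delivered along
the list `l` of pairs (sender, sending time); pairs without a message are skipped. -/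
def packets {M : Type u} (sent : Fin n → ℕ → Fin n → Option M) (q : Fin n)
    (l : List (Fin n × ℕ)) : List (Packet n M) :=
  l.filterMap fun d => (sent d.1 d.2 q).map fun m => ⟨d.1, d.2, m⟩

theorem mem_packets {M : Type u} {sent : Fin n → ℕ → Fin n → Option M} {q : Fin n}
    {l : List (Fin n × ℕ)} {d : Packet n M} :
    d ∈ packets sent q l ↔ (d.sender, d.sentAt) ∈ l ∧ sent d.sender d.sentAt q = some d.msg := by
  obtain ⟨p, s, m⟩ := d
  simp only [packets, List.mem_filterMap, Option.map_eq_some_iff, Packet.mk.injEq]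
  constructor
  · rintro ⟨⟨a, b⟩, h, m', h', rfl, rfl, rfl⟩
    exact ⟨h, h'⟩
  · rintro ⟨h, h'⟩
    exact ⟨_, h, m, h', rfl, rfl, rfl⟩

theorem nodup_packets {M : Type u} {sent : Fin n → ℕ → Fin n → Option M} {q : Fin n}
    {l : List (Fin n × ℕ)} (h : l.Nodup) : (packets sent q l).Nodup := by
  refine List.Nodup.filterMap ?_ h
  rintro ⟨a, b⟩ ⟨a', b'⟩ d h h'
  simp only [Option.mem_def, Option.map_eq_some_iff] at h h'
  obtain ⟨m, -, rfl⟩ := h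
  obtain ⟨m', -, h'⟩ := h'
  simp only [Packet.mk.injEq] at h'
  simp [h'.1, h'.2.1]

theorem packets_congr {M : Type u} {sent sent' : Fin n → ℕ → Fin n → Option M} {q : Fin n}
    {l : List (Fin n × ℕ)} (h : ∀ d ∈ l, sent d.1 d.2 = sent' d.1 d.2) :
    packets sent q l = packets sent' q l :=
  List.filterMap_congr fun d hd => by rw [h d hd]

namespace Run

variable {P : Protocol n V} {Δ : ℕ}

/-- Senders and sending times of the messages that a run delivers to `q` at time `t`. -/
def arrivals (r : Run P Δ) (q : Fin n) (t : ℕ) : List (Fin n × ℕ) :=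
  (r.inbox q t).map fun d => (d.sender, d.sentAt)

variable (r : Run P Δ)

theorem mem_arrivals {q : Fin n} {t : ℕ} {d : Fin n × ℕ} :
    d ∈ r.arrivals q t ↔ ∃ m, (⟨d.1, d.2, m⟩ : Packet n P.Msg) ∈ r.inbox q t := by
  simp only [arrivals, List.mem_map]
  constructor
  · rintro ⟨⟨p, s, m⟩, h, rfl⟩
    exact ⟨m, h⟩
  · rintro ⟨m, h⟩
    exact ⟨_, h, rfl⟩

theorem lt_of_mem_arrivals {q : Fin n} {t : ℕ} {d : Fin n × ℕ} (h : d ∈ r.arrivals q t) :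
    d.2 < t := by
  obtain ⟨m, h⟩ := r.mem_arrivals.1 h
  exact (r.inbox_sent q t _ h).1

theorem packet_eq {q : Fin n} {t t' : ℕ} {d d' : Packet n P.Msg} (h : d ∈ r.inbox q t)
    (h' : d' ∈ r.inbox q t') (hp : d.sender = d'.sender) (hs : d.sentAt = d'.sentAt) :
    d = d' := by
  have h1 := (r.inbox_sent q t _ h).2
  have h2 := (r.inbox_sent q t' _ h').2
  obtain ⟨p, s, m⟩ := d
  obtain ⟨p', s', m'⟩ := d'
  simp only at hp hs h1 h2
  subst hp hs
  rw [h1] at h2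
  simp_all

theorem nodup_arrivals (q : Fin n) (t : ℕ) : (r.arrivals q t).Nodup := by
  refine (List.nodup_map_iff_inj_on (r.inbox_nodup q t)).2 fun d hd d' hd' h => ?_
  simp only [Prod.mk.injEq] at h
  exact r.packet_eq hd hd' h.1 h.2

theorem arrivals_unique {q : Fin n} {t t' : ℕ} {d : Fin n × ℕ} (h : d ∈ r.arrivals q t)
    (h' : d ∈ r.arrivals q t') : t = t' := by
  obtain ⟨m, h⟩ := r.mem_arrivals.1 h
  obtain ⟨m', h'⟩ := r.mem_arrivals.1 h'
  have := r.packet_eq h h' rfl rfl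
  exact r.inbox_unique q t t' _ h (this ▸ h')

/-- An inbox can be rebuilt from senders and sending times alone, so a delivery pattern can be
replayed in another run without knowing the contents of the messages. -/
theorem packets_arrivals (q : Fin n) (t : ℕ) :
    packets r.sent q (r.arrivals q t) = r.inbox q t := by
  have h : ∀ d ∈ r.inbox q t, r.sent d.sender d.sentAt q = some d.msg :=
    fun d hd => (r.inbox_sent q t d hd).2
  unfold packets arrivals
  generalize r.inbox q t = l at h ⊢
  induction l with
  | nil => rfl
  | cons d l ih =>
    rw [List.map_cons, List.filterMap_cons]
    simp only [h d List.mem_cons_self, Option.map_some]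
    rw [ih fun d hd => h d (List.mem_cons_of_mem _ hd)]

/-- A process that never takes a step sends nothing. -/
theorem active_of_mem_arrivals {q : Fin n} {t : ℕ} {d : Fin n × ℕ} (h : d ∈ r.arrivals q t) :
    r.active d.1 d.2 := by
  by_contra hna
  obtain ⟨m, h⟩ := r.mem_arrivals.1 h
  have h1 := (r.inbox_sent q t _ h).2
  have h2 := (r.step_idle _ _ hna).2.1
  simp only at h1
  rw [h2] at h1
  cases h1

/-- Two runs agree on each process `q` before time `K q` if up to then the processes are active,
start from the same proposals, and get, along the same lists of senders and sending times, only
messages that were sent before the cutoff time of their sender. -/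
theorem agree (r' : Run P Δ) (K : Fin n → ℕ∞)
    (hI : ∀ q, 0 < K q → r.proposal q = r'.proposal q)
    (hact : ∀ q (t : ℕ), t < K q → r.active q t ∧ r'.active q t)
    (hin : ∀ q (t : ℕ), t < K q → ∃ l, r.inbox q t = packets r.sent q l ∧
      r'.inbox q t = packets r'.sent q l ∧ ∀ d ∈ l, d.2 < t ∧ (d.2 : ℕ∞) < K d.1)
    (t : ℕ) : ∀ q, t < K q → r.state q (t + 1) = r'.state q (t + 1) ∧
      r.sent q t = r'.sent q t ∧ r.output q t = r'.output q t := by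
  induction t using Nat.strong_induction_on with
  | _ t ih =>
    intro q hq
    have hst : r.state q t = r'.state q t := by
      cases t with
      | zero => rw [r.state_zero, r'.state_zero, hI q (by simpa using hq)]
      | succ t =>
        exact (ih t t.lt_succ_self q (lt_trans (by exact_mod_cast t.lt_succ_self) hq)).1
    obtain ⟨l, h1, h2, h3⟩ := hin q t hq
    have hbox : r.inbox q t = r'.inbox q t := by
      rw [h1, h2]
      exact packets_congr fun d hd => (ih d.2 (h3 d hd).1 d.1 (h3 d hd).2).2.1
    have e1 := r.step_active q t (hact q t hq).1
    have e2 := r'.step_active q t (hact q t hq).2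
    rw [hst, hbox, ← e2] at e1
    simpa using e1

theorem FaultySynchronous.arrival_time {r : Run P Δ} {E : Finset (Fin n)}
    (h : r.FaultySynchronous E) {q : Fin n} (hq : q ∉ E) {t : ℕ} {d : Fin n × ℕ}
    (hd : d ∈ r.arrivals q t) : t = (d.2 / Δ + 1) * Δ := by
  obtain ⟨m, hm⟩ := r.mem_arrivals.1 hd
  exact r.inbox_unique q _ _ _ hm (h.delivery _ _ _ _ hq (r.inbox_sent q t _ hm).2)

end Run

/-! ### Constructing runs from schedules -/

/-- A message schedule that does not depend on the protocol: when the processes crash, and in which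
order messages are delivered, each identified by its sender and its sending time. -/
structure Schedule (n Δ : ℕ) where
  crash : Fin n → ℕ∞
  gst : ℕ
  deliv : Fin n → ℕ → List (Fin n × ℕ)
  deliv_crashed : ∀ q (t : ℕ), ¬ (t : ℕ∞) < crash q → deliv q t = []
  deliv_lt : ∀ q t, ∀ d ∈ deliv q t, d.2 < t
  deliv_nodup : ∀ q t, (deliv q t).Nodup
  deliv_unique : ∀ q t t', ∀ d ∈ deliv q t, d ∈ deliv q t' → t = t'
  deliv_reliable : ∀ p q s, crash p = ⊤ → crash q = ⊤ → ∃ t, (p, s) ∈ deliv q t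
  deliv_delay : ∀ q t, ∀ d ∈ deliv q t, t ≤ max d.2 gst + Δ

namespace Schedule

noncomputable section

variable {Δ : ℕ} (S : Schedule n Δ) (P : Protocol n V) (I : Fin n → V)

open Classical in
/-- The effect of time step `t` on process `p`, from the states of all processes and the log of all
messages sent before. -/
def result (t : ℕ) (state : Fin n → P.State) (log : Fin n → ℕ → Fin n → Option P.Msg)
    (p : Fin n) : StepResult n V P.State P.Msg :=
  if (t : ℕ∞) < S.crash p then
    P.step p (state p) ((packets log p (S.deliv p t)).map fun d => (d.sender, d.msg))
  else ⟨state p, fun _ => none, none⟩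

/-- The states at time `t` and the log of the messages sent before time `t`. -/
def exec : ℕ → (Fin n → P.State) × (Fin n → ℕ → Fin n → Option P.Msg)
  | 0 => (fun p => P.init p (I p), fun _ _ _ => none)
  | t + 1 =>
    (fun p => (S.result P t (exec t).1 (exec t).2 p).state,
      fun p s => if s = t then (S.result P t (exec t).1 (exec t).2 p).send else (exec t).2 p s)

/-- The result of process `p`'s step at time `t`. -/
def stepAt (p : Fin n) (t : ℕ) : StepResult n V P.State P.Msg :=
  S.result P t (S.exec P I t).1 (S.exec P I t).2 p

theorem exec_log {s t : ℕ} (h : s < t) (p : Fin n) :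
    (S.exec P I t).2 p s = (S.stepAt P I p s).send := by
  induction t with
  | zero => omega
  | succ t ih =>
    simp only [exec]
    by_cases hst : s = t
    · subst hst
      simp [stepAt]
    · rw [if_neg hst, ih (by omega)]

theorem packets_exec (q : Fin n) (t : ℕ) :
    packets (S.exec P I t).2 q (S.deliv q t) =
      packets (fun p s => (S.stepAt P I p s).send) q (S.deliv q t) :=
  packets_congr fun d hd => S.exec_log P I (S.deliv_lt q t d hd) d.1

/-- The run of a protocol under a schedule. -/
def run : Run P Δ where
  proposal := I
  crash := S.crash
  gst := S.gst
  active p t := (t : ℕ∞) < S.crash p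
  inbox q t := packets (fun p s => (S.stepAt P I p s).send) q (S.deliv q t)
  state p t := (S.exec P I t).1 p
  sent p t := (S.stepAt P I p t).send
  output p t := (S.stepAt P I p t).decision
  state_zero p := rfl
  step_active p t h := by
    rw [← packets_exec]
    change S.stepAt P I p t = _
    rw [stepAt, result, if_pos h]
  step_idle p t h := by
    have : S.stepAt P I p t = ⟨(S.exec P I t).1 p, fun _ => none, none⟩ := by
      rw [stepAt, result, if_neg h]
    refine ⟨?_, by rw [this], by rw [this], by rw [S.deliv_crashed p t h]; rfl⟩
    change (S.stepAt P I p t).state = _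
    rw [this]
  active_lt_crash p t h := h
  inbox_sent q t d hd := by
    obtain ⟨h1, h2⟩ := mem_packets.1 hd
    exact ⟨S.deliv_lt q t _ h1, h2⟩
  inbox_nodup q t := nodup_packets (S.deliv_nodup q t)
  inbox_unique q t t' d hd hd' :=
    S.deliv_unique q t t' _ (mem_packets.1 hd).1 (mem_packets.1 hd').1
  reliable p q s m hp hq hm := by
    obtain ⟨t, ht⟩ := S.deliv_reliable p q s hp hq
    exact ⟨t, mem_packets.2 ⟨ht, hm⟩⟩
  delay_le q t d hd := S.deliv_delay q t _ (mem_packets.1 hd).1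
  prompt p t _ h := h

theorem run_inbox (q : Fin n) (t : ℕ) :
    (S.run P I).inbox q t = packets (S.run P I).sent q (S.deliv q t) := rfl

/-- The schedule of `E`-faulty synchronous runs in which simultaneous messages arrive in the order
of their senders in the list `L`. -/
def sync (hΔ : 0 < Δ) (E : Finset (Fin n)) (L : List (Fin n)) (hL : L.Nodup)
    (hmem : ∀ p, p ∈ L) : Schedule n Δ where
  crash p := if p ∈ E then 0 else ⊤
  gst := 0
  -- The whole previous round is delivered, ordered by sender first, so the head of `L` is heard
  -- before everyone else.
  deliv q t := if q ∉ E ∧ 0 < t ∧ Δ ∣ t then L ×ˢ List.range' (t - Δ) Δ else []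
  deliv_crashed q t h := by
    by_cases hq : q ∈ E <;> simp_all
  deliv_lt q t d hd := by
    split_ifs at hd with h
    · obtain ⟨-, h0, k, rfl⟩ := h
      have := (List.mem_range'_1.1 (List.mem_product.1 hd).2)
      have : 0 < k := Nat.pos_of_mul_pos_left h0
      have : Δ ≤ Δ * k := Nat.le_mul_of_pos_right _ this
      omega
    · simp at hd
  deliv_nodup q t := by
    split_ifs
    · exact hL.product (List.nodup_range' )
    · simp
  deliv_unique q t t' d hd hd' := by
    split_ifs at hd with h
    swap
    · simp at hd
    split_ifs at hd' with h'
    swap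
    · simp at hd'
    obtain ⟨-, h0, k, rfl⟩ := h
    obtain ⟨-, h0', k', rfl⟩ := h'
    have h1 := (List.mem_range'_1.1 (List.mem_product.1 hd).2)
    have h2 := (List.mem_range'_1.1 (List.mem_product.1 hd').2)
    have hk : 0 < k := Nat.pos_of_mul_pos_left h0
    have hk' : 0 < k' := Nat.pos_of_mul_pos_left h0'
    obtain ⟨k, rfl⟩ := Nat.exists_eq_succ_of_ne_zero hk.ne'
    obtain ⟨k', rfl⟩ := Nat.exists_eq_succ_of_ne_zero hk'.ne'
    simp only [Nat.mul_succ, Nat.add_sub_cancel] at *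
    have e1 : d.2 / Δ = k := Nat.div_eq_of_lt_le (by nlinarith) (by nlinarith)
    have e2 : d.2 / Δ = k' := Nat.div_eq_of_lt_le (by nlinarith) (by nlinarith)
    rw [← e1, ← e2]
  deliv_reliable p q s _ hq := by
    refine ⟨Δ * (s / Δ + 1), ?_⟩
    have hqE : q ∉ E := by
      intro h
      simp [h] at hq
    rw [if_pos ⟨hqE, by positivity, Dvd.intro _ rfl⟩]
    refine List.mem_product.2 ⟨hmem p, List.mem_range'_1.2 ?_⟩
    have := Nat.div_add_mod s Δ
    have := Nat.mod_lt s hΔ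
    simp only [Nat.mul_add, mul_one, Nat.add_sub_cancel]
    omega
  deliv_delay q t d hd := by
    split_ifs at hd with h
    · have := (List.mem_range'_1.1 (List.mem_product.1 hd).2)
      omega
    · simp at hd

theorem sync_faultySynchronous (hΔ : 0 < Δ) (E : Finset (Fin n)) (L : List (Fin n))
    (hL : L.Nodup) (hmem : ∀ p, p ∈ L) :
    ((sync hΔ E L hL hmem).run P I).FaultySynchronous E where
  correct p hp := by simp [Run.Correct, run, sync, hp]
  crashed p hp := by simp [run, sync, hp]
  delivery p q s m hq hm := by
    rw [run_inbox]
    refine mem_packets.2 ⟨?_, hm⟩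
    simp only [sync]
    rw [if_pos ⟨hq, by positivity, Dvd.intro_left _ rfl⟩]
    refine List.mem_product.2 ⟨hmem p, List.mem_range'_1.2 ?_⟩
    have := Nat.div_add_mod s Δ
    have := Nat.mod_lt s hΔ
    simp only [mul_comm _ Δ, Nat.mul_add, mul_one, Nat.add_sub_cancel]
    omega
  instantaneous p t hp := by simp [run, sync, hp]

open Classical in
/-- Every process `q` gets its messages as in the run `g q` before time `c q`, and none between
`c q` and the stabilization time `T`. At time `T` the processes outside `Q` crash, and
afterwards only messages between processes in `Q` are delivered. -/
def hybrid (hΔ : 0 < Δ) {P : Protocol n V} (g : Fin n → Run P Δ) (Q : Finset (Fin n))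
    (c : Fin n → ℕ) (T : ℕ) (hc : ∀ q, c q ≤ T) : Schedule n Δ :=
  -- An arrival is a replayed message, part of the backlog released at `T` (which omits what was
  -- replayed), or a message sent one tick earlier. Causality, uniqueness and the delay bound follow
  -- by comparing these cases.
  have key : ∀ q t (d : Fin n × ℕ), d ∈ (if t < c q then (g q).arrivals q t
      else if q ∈ Q ∧ t = T then (Q ×ˢ Finset.range T).toList.filter
        fun d => decide (∀ t' < c q, d ∉ (g q).arrivals q t')
      else if q ∈ Q ∧ T < t then Q.toList.map fun p => (p, t - 1) else []) →
      (t < c q ∧ d ∈ (g q).arrivals q t) ∨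
      (t = T ∧ d.2 < T ∧ ∀ t' < c q, d ∉ (g q).arrivals q t') ∨ (T < t ∧ d.2 + 1 = t) := by
    intro q t d hd
    split_ifs at hd with h1 h2 h3
    · exact .inl ⟨h1, hd⟩
    · simp only [List.mem_filter, Finset.mem_toList, Finset.mem_product, Finset.mem_range,
        decide_eq_true_eq] at hd
      exact .inr (.inl ⟨h2.2, hd.1.2, hd.2⟩)
    · simp only [List.mem_map, Finset.mem_toList] at hd
      obtain ⟨p, -, rfl⟩ := hd
      exact .inr (.inr ⟨h3.2, by simp only; omega⟩)
    · simp at hd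
  { crash := fun q => if q ∈ Q then ⊤ else T
    gst := T
    deliv := fun q t =>
      if t < c q then (g q).arrivals q t
      else if q ∈ Q ∧ t = T then (Q ×ˢ Finset.range T).toList.filter
        fun d => decide (∀ t' < c q, d ∉ (g q).arrivals q t')
      else if q ∈ Q ∧ T < t then Q.toList.map fun p => (p, t - 1) else []
    deliv_crashed := by
      intro q t h
      have := hc q
      by_cases hq : q ∈ Q
      · simp [hq] at h
      · simp only [hq, if_false, Nat.cast_lt, not_lt] at h
        rw [if_neg (by omega), if_neg (by simp [hq]), if_neg (by simp [hq])]
    deliv_lt := by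
      intro q t d hd
      rcases key q t d hd with h | h | h
      · exact (g q).lt_of_mem_arrivals h.2
      · omega
      · omega
    deliv_nodup := by
      intro q t
      split_ifs
      · exact (g q).nodup_arrivals q t
      · exact (Finset.nodup_toList _).filter _
      · exact (Finset.nodup_toList _).map fun a b h => by simpa using h
      · simp
    deliv_unique := by
      intro q t t' d hd hd'
      have := hc q
      rcases key q t d hd with h | h | h <;> rcases key q t' d hd' with h' | h' | h'
      · exact (g q).arrivals_unique h.2 h'.2
      · exact absurd h.2 (h'.2.2 t h.1)
      · have := (g q).lt_of_mem_arrivals h.2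
        omega
      · exact absurd h'.2 (h.2.2 t' h'.1)
      · omega
      · omega
      · have := (g q).lt_of_mem_arrivals h'.2
        omega
      · omega
      · omega
    deliv_reliable := by
      intro p q s hp hq
      have hpQ : p ∈ Q := by
        by_contra h
        simp [h] at hp
      have hqQ : q ∈ Q := by
        by_contra h
        simp [h] at hq
      have := hc q
      by_cases hs : s < T
      · by_cases hd : ∃ t' < c q, (p, s) ∈ (g q).arrivals q t'
        · obtain ⟨t', h, h'⟩ := hd
          exact ⟨t', by rw [if_pos h]; exact h'⟩
        · push Not at hd
          refine ⟨T, ?_⟩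
          rw [if_neg (by omega), if_pos ⟨hqQ, rfl⟩]
          simp only [List.mem_filter, Finset.mem_toList, Finset.mem_product, Finset.mem_range,
            decide_eq_true_eq]
          exact ⟨⟨hpQ, hs⟩, hd⟩
      · refine ⟨s + 1, ?_⟩
        rw [if_neg (by omega), if_neg (by omega), if_pos ⟨hqQ, by omega⟩]
        simpa using hpQ
    deliv_delay := by
      intro q t d hd
      have := hc q
      rcases key q t d hd with h | h | h <;> omega }

end

end Schedule

end TwoStepConsensus
-- Hybrid runs
namespace TwoStepConsensus

variable {n : ℕ} {V : Type u}

namespace Schedule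

variable {Δ : ℕ} {P : Protocol n V}

theorem hybrid_active_of_lt (hΔ : 0 < Δ) (g : Fin n → Run P Δ) (Q : Finset (Fin n))
    (c : Fin n → ℕ) (T : ℕ) (hc : ∀ q, c q ≤ T) (I : Fin n → V) {q : Fin n} {t : ℕ}
    (ht : t < T) : ((hybrid hΔ g Q c T hc).run P I).active q t := by
  change (t : ℕ∞) < if q ∈ Q then ⊤ else (T : ℕ∞)
  split_ifs
  · exact ENat.natCast_lt_top t
  · exact_mod_cast ht

theorem hybrid_active_of_mem (hΔ : 0 < Δ) (g : Fin n → Run P Δ) (Q : Finset (Fin n))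
    (c : Fin n → ℕ) (T : ℕ) (hc : ∀ q, c q ≤ T) (I : Fin n → V) {q : Fin n} (hq : q ∈ Q)
    (t : ℕ) : ((hybrid hΔ g Q c T hc).run P I).active q t := by
  change (t : ℕ∞) < if q ∈ Q then ⊤ else (T : ℕ∞)
  rw [if_pos hq]
  exact ENat.natCast_lt_top t

theorem hybrid_correct_iff (hΔ : 0 < Δ) (g : Fin n → Run P Δ) (Q : Finset (Fin n))
    (c : Fin n → ℕ) (T : ℕ) (hc : ∀ q, c q ≤ T) (I : Fin n → V) {q : Fin n} :
    ((hybrid hΔ g Q c T hc).run P I).Correct q ↔ q ∈ Q := by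
  change (if q ∈ Q then ⊤ else (T : ℕ∞)) = ⊤ ↔ _
  split_ifs with h <;> simp [h]

theorem hybrid_faulty (hΔ : 0 < Δ) (g : Fin n → Run P Δ) (Q : Finset (Fin n))
    (c : Fin n → ℕ) (T : ℕ) (hc : ∀ q, c q ≤ T) (I : Fin n → V) :
    {q | ¬ ((hybrid hΔ g Q c T hc).run P I).Correct q}.ncard = n - Q.card := by
  have : {q | ¬ ((hybrid hΔ g Q c T hc).run P I).Correct q} = ((Qᶜ : Finset (Fin n)) : Set _) := by
    ext q
    simp [hybrid_correct_iff]
  rw [this, Set.ncard_coe_finset, Finset.card_compl, Fintype.card_fin]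

theorem hybrid_inbox_of_lt (hΔ : 0 < Δ) (g : Fin n → Run P Δ) (Q : Finset (Fin n))
    (c : Fin n → ℕ) (T : ℕ) (hc : ∀ q, c q ≤ T) (I : Fin n → V) {q : Fin n} {t : ℕ}
    (ht : t < c q) : ((hybrid hΔ g Q c T hc).run P I).inbox q t =
      packets ((hybrid hΔ g Q c T hc).run P I).sent q ((g q).arrivals q t) := by
  rw [run_inbox]
  congr 1
  exact if_pos ht

/-- The processes that follow the run `σ` in a hybrid run decide as in `σ`, if in `σ` the other
processes are crashed from the beginning. -/
theorem hybrid_output (hΔ : 0 < Δ) (g : Fin n → Run P Δ) (Q : Finset (Fin n))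
    (c : Fin n → ℕ) (T : ℕ) (hc : ∀ q, c q ≤ T) (hT : ∀ q, T ≤ c q + 1) (I : Fin n → V)
    (σ : Run P Δ) (S : Set (Fin n)) (hg : ∀ q ∈ S, g q = σ)
    (hI : ∀ q ∈ S, I q = σ.proposal q) (hact : ∀ q ∈ S, ∀ t, σ.active q t)
    (hS : ∀ q, q ∉ S → σ.crash q = 0) {q : Fin n} (hq : q ∈ S) {t : ℕ} (ht : t < c q) :
    ((hybrid hΔ g Q c T hc).run P I).output q t = σ.output q t := by
  classical
  refine (Run.agree ((hybrid hΔ g Q c T hc).run P I) σ (fun q => if q ∈ S then (c q : ℕ∞) else 0)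
    ?_ ?_ ?_ t q (by simpa [hq] using ht)).2.2
  · intro q h
    by_cases hqS : q ∈ S
    · exact hI q hqS
    · simp [hqS] at h
  · intro q t h
    by_cases hqS : q ∈ S
    · simp only [hqS, if_true, Nat.cast_lt] at h
      exact ⟨hybrid_active_of_lt hΔ g Q c T hc I (h.trans_le (hc q)), hact q hqS t⟩
    · simp [hqS] at h
  · intro q t h
    by_cases hqS : q ∈ S
    · simp only [hqS, if_true, Nat.cast_lt] at h
      refine ⟨σ.arrivals q t, ?_, (σ.packets_arrivals q t).symm, fun d hd => ?_⟩
      · rw [hybrid_inbox_of_lt hΔ g Q c T hc I h, hg q hqS]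
      · have h1 := σ.lt_of_mem_arrivals hd
        have hdS : d.1 ∈ S := by
          by_contra hd1
          have := σ.active_lt_crash _ _ (σ.active_of_mem_arrivals hd)
          rw [hS _ hd1] at this
          simp at this
        refine ⟨h1, ?_⟩
        rw [if_pos hdS]
        -- A message received before `c q ≤ T` was sent by time `T - 2`, hence before the cutoff of
        -- its sender, which is at least `T - 1`.
        have := hc q
        have := hT d.1
        exact_mod_cast (by omega : d.2 < c d.1)
    · simp [hqS] at h

end Schedule

open Schedule

/-! ### Necessity of the bounds -/

section LowerBound

variable {Δ f e : ℕ} {P : Protocol n V}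

theorem Run.FaultySynchronous.ncard_faulty {r : Run P Δ} {E : Finset (Fin n)}
    (h : r.FaultySynchronous E) : {p | ¬ r.Correct p}.ncard = E.card := by
  rw [← Set.ncard_coe_finset]
  congr 1
  ext p
  simp only [Set.mem_ofPred_eq, Finset.mem_coe]
  constructor
  · exact fun hp => by_contra fun hE => hp (h.correct p hE)
  · intro hp hc
    rw [Run.Correct, h.crashed p hp] at hc
    simp at hc

theorem exists_sync (P : Protocol n V) (hΔ : 0 < Δ) (E : Finset (Fin n)) (I : Fin n → V) :
    ∃ r : Run P Δ, r.proposal = I ∧ r.FaultySynchronous E :=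
  ⟨_, rfl, sync_faultySynchronous P I hΔ E (List.finRange n) (List.nodup_finRange n)
    (List.mem_finRange)⟩

/-- Consensus cannot tolerate the crash of half of the processes. -/
theorem Protocol.Resilient.two_mul_lt [Nontrivial V] (hΔ : 0 < Δ) (hn : 2 ≤ n)
    (hP : P.Resilient Δ f) : 2 * f + 1 ≤ n := by
  by_contra hlt
  obtain ⟨A, hA⟩ := Finset.exists_subset_card_eq (s := (Finset.univ : Finset (Fin n)))
    (n := n / 2) (by simp; omega)
  have hA := hA.2
  have hAc : Aᶜ.card = n - n / 2 := by rw [Finset.card_compl, Fintype.card_fin, hA]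
  obtain ⟨v, w, hvw⟩ := exists_pair_ne V
  have decides : ∀ (E : Finset (Fin n)), E.card ≤ f → ∀ p ∉ E, ∀ v : V, ∃ r : Run P Δ,
      r.proposal = (fun _ => v) ∧ r.FaultySynchronous E ∧ ∃ t, r.DecidesAt p v t := by
    intro E hE p hp v
    obtain ⟨r, h1, h2⟩ := exists_sync P hΔ E fun _ => v
    obtain ⟨hval, -, hterm⟩ := hP r (by rw [h2.ncard_faulty]; exact hE)
    obtain ⟨v', t, h⟩ := hterm p (h2.correct p hp)
    obtain ⟨q, hq⟩ := hval _ _ _ h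
    rw [h1] at hq
    obtain rfl : v = v' := hq
    exact ⟨r, h1, h2, t, h⟩
  obtain ⟨a, ha⟩ : A.Nonempty := Finset.card_pos.1 (by omega)
  obtain ⟨b, hb⟩ : Aᶜ.Nonempty := Finset.card_pos.1 (by omega)
  obtain ⟨r, hr1, hr2, t, ht⟩ := decides Aᶜ (by omega) a (by simpa using ha) v
  obtain ⟨r', hr1', hr2', t', ht'⟩ := decides A (by omega) b (by simpa using hb) w
  have hb' : b ∉ A := by simpa using hb
  set g : Fin n → Run P Δ := fun q => if q ∈ A then r else r' with hg
  set I : Fin n → V := fun q => if q ∈ A then v else w with hI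
  set T := t + t' + 1 with hT
  have o1 : ((hybrid hΔ g Finset.univ (fun _ => T) T fun _ => le_rfl).run P I).output a t
      = r.output a t :=
    hybrid_output hΔ g Finset.univ (fun _ => T) T (fun _ => le_rfl) (fun _ => by omega) I r
      {q | q ∈ A} (fun q hq => if_pos hq) (fun q hq => by rw [hr1]; exact if_pos hq)
      (fun q hq t => hr2.instantaneous q t (by simpa using hq))
      (fun q hq => hr2.crashed q (by simpa using hq)) ha (by omega)
  have o2 : ((hybrid hΔ g Finset.univ (fun _ => T) T fun _ => le_rfl).run P I).output b t'
      = r'.output b t' :=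
    hybrid_output hΔ g Finset.univ (fun _ => T) T (fun _ => le_rfl) (fun _ => by omega) I r'
      {q | q ∉ A} (fun q hq => if_neg hq) (fun q hq => by rw [hr1']; exact if_neg hq)
      (fun q hq t => hr2'.instantaneous q t (by simpa using hq))
      (fun q hq => hr2'.crashed q (by simpa using hq)) hb' (by omega)
  refine hvw ((hP ((hybrid hΔ g Finset.univ (fun _ => T) T fun _ => le_rfl).run P I) ?_).2.1
    a v t b w t' (o1.trans ht) (o2.trans ht'))
  rw [hybrid_faulty]
  simp

/-- Two fast decisions in synchronous runs with disjoint sets of faulty processes are equal, if the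
runs differ only in proposals of processes that are faulty in one of them, and one of the two
deciding processes is correct in both. -/
theorem Protocol.Resilient.fast_decisions_eq (hΔ : 0 < Δ) (hP : P.Resilient Δ f)
    (hfn : f < n) (hn : n < 2 * e + f) {E E' : Finset (Fin n)} (hE : E.card = e) (hE' : E'.card = e)
    (hdisj : Disjoint E E') {r r' : Run P Δ} (hr : r.FaultySynchronous E)
    (hr' : r'.FaultySynchronous E')
    (hI : ∀ q, q ∉ E → q ∉ E' → r.proposal q = r'.proposal q) {p p' : Fin n} {v v' : V}
    {t t' : ℕ} (ht : t ≤ 2 * Δ) (ht' : t' ≤ 2 * Δ) (hv : r.DecidesAt p v t)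
    (hv' : r'.DecidesAt p' v' t') (hpE : p ∉ E) (hpE' : p' ∉ E') (hp' : p' ∉ E) : v = v' := by
  -- The survivors. `p` may lie in `E'` and must be removed, since its step at time 2Δ is to stay
  -- hidden; this leaves 2e - 1 processes, which is enough as n < 2e + f.
  set Q : Finset (Fin n) := (E ∪ E').erase p with hQ
  set I : Fin n → V := fun q => if q ∈ E then r'.proposal q else r.proposal q with hIdef
  -- Only the processes outside `Q`, among them `p` and `p'`, get the second-round messages at time
  -- 2Δ; they crash immediately afterwards.
  set c : Fin n → ℕ := fun q => if q ∈ Q then 2 * Δ else 2 * Δ + 1 with hc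
  have hcT : ∀ q, c q ≤ 2 * Δ + 1 := fun q => by simp only [hc]; split_ifs <;> omega
  have hcT' : ∀ q, 2 * Δ + 1 ≤ c q + 1 := fun q => by simp only [hc]; split_ifs <;> omega
  set g : Run P Δ → Fin n → Run P Δ :=
    fun σ q => if q ∈ E' then r else if q ∈ E then r' else σ with hg
  have hdis : ∀ q, q ∈ E → q ∉ E' := fun q h h' => Finset.disjoint_left.1 hdisj h h'
  have hcard : n - Q.card ≤ f := by
    have h1 : (E ∪ E').card = e + e := by rw [Finset.card_union_of_disjoint hdisj, hE, hE']
    have h2 := Finset.pred_card_le_card_erase (s := E ∪ E') (a := p)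
    rw [← hQ] at h2
    omega
  have hcp : c p = 2 * Δ + 1 := by simp [hc, hQ]
  have hcp' : c p' = 2 * Δ + 1 := by simp [hc, hQ, hp', hpE']
  set α := (hybrid hΔ (g r) Q c (2 * Δ + 1) hcT).run P I with hα
  set α' := (hybrid hΔ (g r') Q c (2 * Δ + 1) hcT).run P I with hα'
  have o1 : α.output p t = r.output p t := by
    refine hybrid_output hΔ (g r) Q c (2 * Δ + 1) hcT hcT' I r {q | q ∉ E} ?_ ?_
      (fun q hq t => hr.instantaneous q t hq) (fun q hq => hr.crashed q (by simpa using hq)) hpE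
      (by omega)
    · intro q hq
      have hq : q ∉ E := hq
      simp [hg, hq]
    · exact fun q hq => if_neg hq
  have o2 : α'.output p' t' = r'.output p' t' := by
    refine hybrid_output hΔ (g r') Q c (2 * Δ + 1) hcT hcT' I r' {q | q ∉ E'} ?_ ?_
      (fun q hq t => hr'.instantaneous q t hq) (fun q hq => hr'.crashed q (by simpa using hq)) hpE'
      (by omega)
    · intro q hq
      have hq : q ∉ E' := hq
      simp [hg, hq]
    · intro q hq
      simp only [hIdef]
      split_ifs with h
      · rfl
      · exact hI q h hq
  have hgE : ∀ q σ, q ∈ E ∨ q ∈ E' → ∃ F, q ∉ F ∧ (g σ q).FaultySynchronous F := by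
    intro q σ hq
    by_cases h' : q ∈ E'
    · exact ⟨E, fun h => hdis q h h', by simpa [hg, h'] using hr⟩
    · have h : q ∈ E := hq.resolve_right h'
      exact ⟨E', h', by simpa [hg, h, h'] using hr'⟩
  -- By the round structure nothing arrives before Δ, and whatever arrives before 2Δ was sent in the
  -- first round.
  have nocut : ∀ (q : Fin n) (σ : Run P Δ), (∃ F, q ∉ F ∧ σ.FaultySynchronous F) →
      ∀ t, ∀ d ∈ σ.arrivals q t, Δ ≤ t ∧ (t < 2 * Δ → d.2 < Δ) := by
    rintro q σ ⟨F, hq, hF⟩ t d hd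
    have h := hF.arrival_time hq hd
    refine ⟨by rw [h]; exact Nat.le_mul_of_pos_left _ (Nat.succ_pos _), fun h2 => ?_⟩
    rw [h] at h2
    have h3 : d.2 / Δ + 1 < 2 := Nat.lt_of_mul_lt_mul_right h2
    exact (Nat.div_eq_zero_iff_lt hΔ).1 (Nat.lt_one_iff.1 (Nat.lt_of_succ_lt_succ h3))
  -- The processes outside `Q` need to agree only before Δ, when they have received nothing: their
  -- later messages never reach `Q`.
  have hsame : ∀ q ∈ Q, ∀ t, α.output q t = α'.output q t := by
    intro q hq t
    refine (Run.agree α α' (fun q => if q ∈ Q then ⊤ else (Δ : ℕ∞)) (fun _ _ => rfl) ?_ ?_ t q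
      (by simp [hq])).2.2
    · intro q t h
      by_cases hqQ : q ∈ Q
      · exact ⟨hybrid_active_of_mem hΔ _ Q c _ hcT I hqQ t,
          hybrid_active_of_mem hΔ _ Q c _ hcT I hqQ t⟩
      · simp only [hqQ, if_false, Nat.cast_lt] at h
        exact ⟨hybrid_active_of_lt hΔ _ Q c _ hcT I (by omega),
          hybrid_active_of_lt hΔ _ Q c _ hcT I (by omega)⟩
    · intro q t h
      by_cases hqQ : q ∈ Q
      · have hqE : q ∈ E ∨ q ∈ E' := Finset.mem_union.1 (Finset.mem_of_mem_erase hqQ)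
        have hgq : g r q = g r' q := by
          simp only [hg]
          rcases hqE with h | h <;> simp [h]
        have hcq : c q = 2 * Δ := if_pos hqQ
        refine ⟨(hybrid hΔ (g r) Q c (2 * Δ + 1) hcT).deliv q t, rfl, ?_, fun d hd =>
          ⟨(hybrid hΔ (g r) Q c (2 * Δ + 1) hcT).deliv_lt q t d hd, ?_⟩⟩
        · rw [hα', run_inbox]
          simp only [hybrid, hgq]
        · by_cases hdQ : d.1 ∈ Q
          · rw [if_pos hdQ]
            exact ENat.natCast_lt_top _
          · rw [if_neg hdQ]
            simp only [hybrid] at hd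
            split_ifs at hd with h1 h2 h3
            · rw [hcq] at h1
              exact_mod_cast (nocut q (g r q) (hgE q r hqE) t d hd).2 h1
            · simp only [List.mem_filter, Finset.mem_toList, Finset.mem_product] at hd
              exact absurd hd.1.1 hdQ
            · simp only [List.mem_map, Finset.mem_toList] at hd
              obtain ⟨p, hp, rfl⟩ := hd
              exact absurd hp hdQ
            · simp at hd
      · simp only [hqQ, if_false, Nat.cast_lt] at h
        have hcq : c q = 2 * Δ + 1 := if_neg hqQ
        have nil : ∀ σ : Run P Δ, (∃ F, q ∉ F ∧ σ.FaultySynchronous F) →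
            σ.arrivals q t = [] := by
          intro σ hσ
          refine List.eq_nil_iff_forall_not_mem.2 fun d hd => ?_
          have := (nocut q σ hσ t d hd).1
          omega
        have hgq : ∀ σ : Run P Δ, σ = r ∨ σ = r' → (g σ q).arrivals q t = [] := by
          intro σ hσ
          by_cases hqE : q ∈ E ∨ q ∈ E'
          · exact nil _ (hgE q σ hqE)
          · push Not at hqE
            refine nil _ ?_
            rcases hσ with rfl | rfl
            · exact ⟨E, hqE.1, by simpa [hg, hqE.1, hqE.2] using hr⟩
            · exact ⟨E', hqE.2, by simpa [hg, hqE.1, hqE.2] using hr'⟩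
        refine ⟨[], ?_, ?_, by simp⟩
        · rw [hα, hybrid_inbox_of_lt hΔ _ Q c _ hcT I (by omega), hgq r (.inl rfl)]
        · rw [hα', hybrid_inbox_of_lt hΔ _ Q c _ hcT I (by omega), hgq r' (.inr rfl)]
  obtain ⟨-, hag, hterm⟩ := hP α (by rw [hα, hybrid_faulty]; exact hcard)
  obtain ⟨-, hag', -⟩ := hP α' (by rw [hα', hybrid_faulty]; exact hcard)
  obtain ⟨q, hq⟩ : Q.Nonempty := Finset.card_pos.1 (by omega)
  obtain ⟨w, s, hw⟩ := hterm q ((hybrid_correct_iff hΔ _ Q c _ hcT I).2 hq)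
  rw [hag p v t q w s (o1.trans hv) hw]
  exact hag' q w s p' v' t' ((hsame q hq s).symm.trans hw) (o2.trans hv')

/-- Below the bound, no synchronous run with binary proposals decides `v` in two steps. -/
theorem Protocol.Resilient.not_fast_decision (hΔ : 0 < Δ) (hP : P.Resilient Δ f)
    (hT : P.TwoStep Δ e) (hef : e ≤ f) (hf : 2 * f + 1 ≤ n) (hn : n < 2 * e + f) {v w : V}
    (hvw : v ≠ w) (k : ℕ) : ∀ (E : Finset (Fin n)) (r : Run P Δ), E.card = e →
    r.FaultySynchronous E → (∀ q, r.proposal q = v ∨ r.proposal q = w) →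
    (∃ W : Finset (Fin n), W.card = k ∧ ∀ q, q ∉ E → (r.proposal q = v ↔ q ∈ W)) →
    ∀ p t, p ∉ E → t ≤ 2 * Δ → ¬ r.DecidesAt p v t := by
  have active_of_output : ∀ {r : Run P Δ} {E : Finset (Fin n)} {p : Fin n} {u : V} {t : ℕ},
      r.FaultySynchronous E → r.DecidesAt p u t → p ∉ E := by
    intro r E p u t hr hd hpE
    have hna : ¬ r.active p t := fun h => by
      have := r.active_lt_crash p t h
      rw [hr.crashed p hpE] at this
      simp at this
    have := (r.step_idle p t hna).2.2.1
    rw [Run.DecidesAt, this] at hd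
    cases hd
  induction k using Nat.strong_induction_on with
  | _ k ih =>
    rintro E r hE hr hbin ⟨W, hW, hWv⟩ p t hp ht hd
    -- If a process other than `p` proposes `v`, crash it in a new run, with `p` alive, and change
    -- the proposals on `E ∪ E'` to `w`. The new fast decision must again be `v`, now with fewer
    -- proposers of `v`.
    by_cases hex : ∃ x ∈ W, x ∉ E ∧ x ≠ p
    · obtain ⟨x, hxW, hxE, hxp⟩ := hex
      obtain ⟨E', hxE', hE'sub, hE'⟩ := Finset.exists_subsuperset_card_eq (n := e)
        (s := {x}) (t := (E ∪ {p})ᶜ) (by simpa using ⟨hxp, hxE⟩)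
        (by simp; omega) (by
          have := Finset.card_union_le E {p}
          rw [Finset.card_compl, Fintype.card_fin]
          rw [Finset.card_singleton] at this
          omega)
      have hdisj : ∀ q, q ∈ E' → q ∉ E ∧ q ≠ p := by
        intro q hq
        simpa [and_comm] using hE'sub hq
      obtain ⟨r', hr'I, hr', p', v', t', ht', hd'⟩ := (hT E' hE').1
        fun q => if q ∈ E ∨ q ∈ E' then w else r.proposal q
      have hbin' : ∀ q, r'.proposal q = v ∨ r'.proposal q = w := by
        intro q
        rw [hr'I]
        by_cases h : q ∈ E ∨ q ∈ E'
        · exact .inr (if_pos h)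
        · simpa only [if_neg h] using hbin q
      have hp'E' := active_of_output hr' hd'
      have hnot : v' ≠ v := by
        rintro rfl
        refine ih (W \ (E ∪ E')).card ?_ E' r' hE' hr' hbin' ⟨_, rfl, ?_⟩ p' t' hp'E' ht' hd'
        · rw [← hW]
          refine Finset.card_lt_card ⟨Finset.sdiff_subset, fun h => ?_⟩
          have := h hxW
          simp only [Finset.mem_sdiff, Finset.mem_union, not_or] at this
          exact this.2.2 (hxE' (Finset.mem_singleton_self x))
        · intro q hq
          rw [hr'I]
          simp only [hq, or_false, Finset.mem_sdiff, Finset.mem_union]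
          by_cases hqE : q ∈ E
          · simp [hqE, hvw.symm]
          · simpa [hqE] using hWv q hqE
      refine hnot (hP.fast_decisions_eq hΔ (by omega) hn hE' hE ?_ hr' hr ?_ ht' ht hd' hd
        hp'E' hp fun h => (hdisj p h).2 rfl)
      · exact Finset.disjoint_left.2 fun q hq => (hdisj q hq).1
      · intro q h h'
        rw [hr'I]
        simp [h, h']
    · push Not at hex
      obtain ⟨q, hq⟩ := (hP r (by rw [hr.ncard_faulty]; omega)).1 p v t hd
      -- Outside `E` only `p` can still propose `v`. Crashing `p` leaves a run with all proposals
      -- `w`, where the second two-step condition lets `p'` be chosen outside both crashed sets;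
      -- validity makes it decide `w`.
      obtain ⟨E', hxE', hE'sub, hE'⟩ := Finset.exists_subsuperset_card_eq (n := e)
        (s := {p}) (t := Eᶜ) (by simpa using hp)
        (by simp; omega) (by rw [Finset.card_compl, Fintype.card_fin]; omega)
      have hdisj : ∀ q, q ∈ E' → q ∉ E := by
        intro q hq
        simpa using hE'sub hq
      have hpE' : p ∈ E' := hxE' (Finset.mem_singleton_self p)
      obtain ⟨p', hp'⟩ : ((E ∪ E')ᶜ : Finset (Fin n)).Nonempty := by
        have := Finset.card_union_le E E'
        refine Finset.card_pos.1 ?_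
        rw [Finset.card_compl, Fintype.card_fin]
        omega
      simp only [Finset.mem_compl, Finset.mem_union, not_or] at hp'
      obtain ⟨r', hr'I, hr', v', t', ht', hd'⟩ := (hT E' hE').2 (fun _ => w) ⟨w, fun _ _ => rfl⟩
        p' hp'.2
      obtain ⟨q', hq'⟩ := (hP r' (by rw [hr'.ncard_faulty]; omega)).1 p' v' t' hd'
      rw [hr'I] at hq'
      subst hq'
      refine hvw (hP.fast_decisions_eq hΔ (by omega) hn hE hE' ?_ hr hr' ?_ ht ht' hd hd'
        hp hp'.2 hp'.1)
      · exact Finset.disjoint_left.2 fun q hq hq' => hdisj q hq' hq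
      · intro q h h'
        rw [hr'I]
        refine (hbin q).resolve_left fun hqv => h' ?_
        rw [hex q ((hWv q h).1 hqv) h]
        exact hpE'

theorem Protocol.Resilient.two_mul_add_le [Nontrivial V] (hΔ : 0 < Δ) (hP : P.Resilient Δ f)
    (hT : P.TwoStep Δ e) (hef : e ≤ f) (hf : 2 * f + 1 ≤ n) : 2 * e + f ≤ n := by
  by_contra hn
  obtain ⟨v, w, hvw⟩ := exists_pair_ne V
  obtain ⟨E, -, hE⟩ := Finset.exists_subset_card_eq (s := (Finset.univ : Finset (Fin n)))
    (n := e) (by simp; omega)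
  obtain ⟨p, hp⟩ : (Eᶜ : Finset (Fin n)).Nonempty := by
    refine Finset.card_pos.1 ?_
    rw [Finset.card_compl, Fintype.card_fin]
    omega
  have hp : p ∉ E := by simpa using hp
  obtain ⟨r, hrI, hr, v', t, ht, hd⟩ := (hT E hE).2 (fun _ => v) ⟨v, fun _ _ => rfl⟩ p hp
  obtain ⟨q, hq⟩ := (hP r (by rw [hr.ncard_faulty]; omega)).1 p v' t hd
  rw [hrI] at hq
  subst hq
  exact hP.not_fast_decision hΔ hT hef hf (by omega) hvw n E r hE hr
    (fun q => .inl (by rw [hrI])) ⟨Finset.univ, by simp, fun q _ => by simp [hrI]⟩ p t hp ht hd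

end LowerBound

end TwoStepConsensus
-- The protocol: Paxos with a fast ballot
namespace TwoStepConsensus

variable {n : ℕ} {V : Type u}

/-- What a process tells the others about itself: its proposal, its vote for a proposal (with the
proposer), its current ballot, the last ballot in which it has accepted a value (`0` if none) with
that value, and its decision. -/
structure Snapshot (n : ℕ) (V : Type u) where
  initVal : V
  vote : Option (Fin n × V)
  bal : ℕ
  vbal : ℕ
  vval : V
  dec : Option V

/-- The state of a process: its own snapshot, the number of steps it has taken, and
all snapshots received from each process. -/
structure LocalState (n : ℕ) (V : Type u) where
  snap : Snapshot n V
  clock : ℕ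
  heard : Fin n → Set (Snapshot n V)

namespace LocalState

noncomputable section

variable (e f Δ : ℕ) (p : Fin n) (σ : LocalState n V) (inbox : List (Fin n × Snapshot n V))

def hear (j : Fin n) : Set (Snapshot n V) :=
  {x | x ∈ σ.heard j ∨ (j, x) ∈ inbox}

/-- The ballot that a process leads when its clock shows `c`. Ballot `b` is led by process
`b % n`, and the leader starts it when its clock reaches `(b + 2 * Δ + 2) ^ 2`. -/
def ballotAt (c : ℕ) : ℕ :=
  if (Nat.sqrt c - (2 * Δ + 2)) % n = p then Nat.sqrt c - (2 * Δ + 2) else 0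

/-- The clock value used is the one after the current step. -/
def nextBal : ℕ :=
  max (max σ.snap.bal ((inbox.map fun m => m.2.bal).foldr max 0)) (ballotAt Δ p (σ.clock + 1))

open Classical in
/-- A process votes for the first proposal that reaches it and does not exceed its own one,
unless it has joined a ballot before. -/
def nextVote [LE V] (b : ℕ) : Option (Fin n × V) :=
  if σ.snap.vote = none ∧ b = 0 then
    (inbox.find? fun m => decide (m.2.initVal ≤ σ.snap.initVal)).map fun m => (m.1, m.2.initVal)
  else σ.snap.vote

/-- The conditions for the decision of `v` by process `p` with proposal `d` and current ballot `b`: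
it is a decision of another process, or `p`'s own proposal with `n - e` votes while `p` has not
joined any ballot, or it was accepted by `n - f` processes in the same ballot. -/
def CanDecide (d : V) (b : ℕ) (h : Fin n → Set (Snapshot n V)) (v : V) : Prop :=
  (∃ j, ∃ x ∈ h j, x.dec = some v) ∨
  (b = 0 ∧ v = d ∧ ∃ F : Finset (Fin n), n - e ≤ F.card ∧
    ∀ q ∈ F, ∃ x ∈ h q, x.vote = some (p, d)) ∨
  ∃ b', 0 < b' ∧ ∃ Q : Finset (Fin n), n - f ≤ Q.card ∧
    ∀ q ∈ Q, ∃ x ∈ h q, x.vbal = b' ∧ x.vval = v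

open Classical in
def nextDec : Option V :=
  if σ.snap.dec = none then
    if h : ∃ v, CanDecide e f p σ.snap.initVal (nextBal Δ p σ inbox) (σ.hear inbox) v then
      some h.choose
    else none
  else σ.snap.dec

/-- The proposal `v` of process `j`, which is not in the quorum `Q`, may have been decided by
the votes for it. -/
def Candidate (Q : Finset (Fin n)) (y : Fin n → Snapshot n V) (j : Fin n) (v : V) : Prop :=
  j ∉ Q ∧ ∃ G ⊆ Q, n - f - e ≤ G.card ∧ ∀ q ∈ G, (y q).vote = some (j, v)

/-- The leader of a ballot may propose `v`, given the snapshots `y` of a quorum `Q`. -/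
def Safe [LE V] (Q : Finset (Fin n)) (y : Fin n → Snapshot n V) (d v : V) : Prop :=
  (∃ q ∈ Q, 0 < (y q).vbal ∧ (y q).vval = v ∧ ∀ q' ∈ Q, (y q').vbal ≤ (y q).vbal) ∨
  (∀ q ∈ Q, (y q).vbal = 0) ∧
    ((∃ j, Candidate e f Q y j v) ∧ (∀ j' v', Candidate e f Q y j' v' → v ≤ v') ∨
      (∀ j' v', ¬ Candidate e f Q y j' v') ∧ v = d)

/-- The conditions for accepting `v` in the current ballot `b`: another process has accepted it in
this ballot, or `p` leads the ballot and may propose `v`. -/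
def CanAccept [LE V] (d : V) (b : ℕ) (dec : Option V) (h : Fin n → Set (Snapshot n V))
    (v : V) : Prop :=
  (∃ j, ∃ x ∈ h j, x.vbal = b ∧ x.vval = v) ∨
  (b % n = p ∧ dec = none ∧ ∃ (Q : Finset (Fin n)) (y : Fin n → Snapshot n V),
    n - f ≤ Q.card ∧ (∀ q ∈ Q, y q ∈ h q ∧ (y q).bal = b ∧ (y q).vbal < b) ∧ Safe e f Q y d v)

open Classical in
def nextAccepted [LE V] : ℕ × V :=
  if h : σ.snap.vbal < nextBal Δ p σ inbox ∧ ∃ v, CanAccept e f p σ.snap.initVal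
      (nextBal Δ p σ inbox) (nextDec e f Δ p σ inbox) (σ.hear inbox) v then
    (nextBal Δ p σ inbox, h.2.choose)
  else (σ.snap.vbal, σ.snap.vval)

def next [LE V] : LocalState n V where
  snap :=
    { initVal := σ.snap.initVal
      vote := nextVote σ inbox (nextBal Δ p σ inbox)
      bal := nextBal Δ p σ inbox
      vbal := (nextAccepted e f Δ p σ inbox).1
      vval := (nextAccepted e f Δ p σ inbox).2
      dec := nextDec e f Δ p σ inbox }
  clock := σ.clock + 1
  heard := σ.hear inbox

variable {e f Δ p σ inbox}

theorem le_foldr_max {l : List ℕ} {a : ℕ} (h : a ∈ l) : a ≤ l.foldr max 0 := by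
  induction l with
  | nil => simp at h
  | cons b l ih =>
    rcases List.mem_cons.1 h with rfl | h
    · exact le_max_left _ _
    · exact (ih h).trans (le_max_right _ _)

theorem foldr_max_le {l : List ℕ} {a : ℕ} (h : ∀ b ∈ l, b ≤ a) : l.foldr max 0 ≤ a := by
  induction l with
  | nil => exact Nat.zero_le a
  | cons b l ih =>
    exact max_le (h b List.mem_cons_self) (ih fun c hc => h c (List.mem_cons_of_mem _ hc))

theorem le_nextBal : σ.snap.bal ≤ nextBal Δ p σ inbox :=
  (le_max_left _ _).trans (le_max_left _ _)

theorem le_nextBal_of_mem {j : Fin n} {x : Snapshot n V} (h : (j, x) ∈ inbox) :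
    x.bal ≤ nextBal Δ p σ inbox :=
  (le_foldr_max (l := inbox.map fun m => m.2.bal) (List.mem_map.2 ⟨_, h, rfl⟩)).trans ((le_max_right _ _).trans (le_max_left _ _))

theorem nextDec_of_ne_none (h : σ.snap.dec ≠ none) :
    nextDec e f Δ p σ inbox = σ.snap.dec := if_neg h

theorem canDecide_of_nextDec {v : V} (h0 : σ.snap.dec = none)
    (h : nextDec e f Δ p σ inbox = some v) :
    CanDecide e f p σ.snap.initVal (nextBal Δ p σ inbox) (σ.hear inbox) v := by
  rw [nextDec, if_pos h0] at h
  split_ifs at h with hex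
  rw [← Option.some.inj h]
  exact hex.choose_spec

theorem nextDec_ne_none {v : V}
    (h : CanDecide e f p σ.snap.initVal (nextBal Δ p σ inbox) (σ.hear inbox) v) :
    nextDec e f Δ p σ inbox ≠ none := by
  rw [nextDec]
  split_ifs with h1 h2
  · simp
  · exact absurd ⟨v, h⟩ h2
  · exact h1

theorem nextAccepted_cases [LE V] :
    nextAccepted e f Δ p σ inbox = (σ.snap.vbal, σ.snap.vval) ∨
    σ.snap.vbal < nextBal Δ p σ inbox ∧
      (nextAccepted e f Δ p σ inbox).1 = nextBal Δ p σ inbox ∧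
      CanAccept e f p σ.snap.initVal (nextBal Δ p σ inbox) (nextDec e f Δ p σ inbox)
        (σ.hear inbox) (nextAccepted e f Δ p σ inbox).2 := by
  rw [nextAccepted]
  split_ifs with h
  · exact .inr ⟨h.1, rfl, h.2.choose_spec⟩
  · exact .inl rfl

theorem nextAccepted_fst [LE V] {v : V} (h0 : σ.snap.vbal < nextBal Δ p σ inbox)
    (h : CanAccept e f p σ.snap.initVal (nextBal Δ p σ inbox) (nextDec e f Δ p σ inbox)
        (σ.hear inbox) v) : (nextAccepted e f Δ p σ inbox).1 = nextBal Δ p σ inbox := by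
  rw [nextAccepted, dif_pos ⟨h0, v, h⟩]

theorem nextVote_cases [LE V] {b : ℕ} {j : Fin n} {v : V} (h : nextVote σ inbox b = some (j, v)) :
    σ.snap.vote = some (j, v) ∨
    ∃ x, (j, x) ∈ inbox ∧ x.initVal = v ∧ v ≤ σ.snap.initVal := by
  rw [nextVote] at h
  split_ifs at h with h0
  · obtain ⟨⟨j', x⟩, h1, h2⟩ := Option.map_eq_some_iff.1 h
    simp only [Prod.mk.injEq] at h2
    obtain ⟨rfl, rfl⟩ := h2
    refine .inr ⟨x, List.mem_of_find?_eq_some h1, rfl, ?_⟩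
    simpa using List.find?_some h1
  · exact .inl h

theorem nextVote_eq [LE V] {b : ℕ} (h : σ.snap.vote ≠ none ∨ b ≠ 0) :
    nextVote σ inbox b = σ.snap.vote := by
  rw [nextVote, if_neg]
  tauto

/-- A leader with a quorum is never stuck: well-foundedness supplies the least candidate when
nothing has been accepted. -/
theorem exists_safe [LinearOrder V] [WellFoundedLT V] {Q : Finset (Fin n)} (hQ : Q.Nonempty)
    (y : Fin n → Snapshot n V) (d : V) : ∃ v, Safe e f Q y d v := by
  obtain ⟨q, hq, hmax⟩ := Q.exists_max_image (fun q => (y q).vbal) hQ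
  rcases Nat.eq_zero_or_pos (y q).vbal with h0 | h0
  · by_cases hc : ∃ v j, Candidate e f Q y j v
    · obtain ⟨v, hv, hmin⟩ := WellFounded.has_min (wellFounded_lt (α := V))
        {v | ∃ j, Candidate e f Q y j v} hc
      exact ⟨v, .inr ⟨fun q' hq' => Nat.le_zero.1 (h0 ▸ hmax q' hq'), .inl ⟨hv,
        fun j' v' h => not_lt.1 (hmin v' ⟨j', h⟩)⟩⟩⟩
    · push Not at hc
      exact ⟨d, .inr ⟨fun q' hq' => Nat.le_zero.1 (h0 ▸ hmax q' hq'),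
        .inr ⟨fun j' v' => hc v' j', rfl⟩⟩⟩
  · exact ⟨(y q).vval, .inl ⟨q, hq, h0, rfl, hmax⟩⟩

end

end LocalState

open LocalState

/-- The protocol: in each step, every process updates its state from the snapshots it receives, and
sends its own snapshot to all processes. -/
noncomputable def gossip [LE V] (n e f Δ : ℕ) : Protocol n V where
  State := LocalState n V
  Msg := Snapshot n V
  init _ v := ⟨⟨v, none, 0, 0, v, none⟩, 0, fun _ => ∅⟩
  step p σ inbox :=
    ⟨next e f Δ p σ inbox, fun _ => some (next e f Δ p σ inbox).snap,
      if σ.snap.dec = none then (next e f Δ p σ inbox).snap.dec else none⟩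

/-! ### Invariants of the protocol -/

namespace Gossip

variable {e f Δ : ℕ}

section Basic

variable [LE V] (r : Run (gossip (V := V) n e f Δ) Δ)

/-- The local state of process `p` just before time `t`. -/
def st (p : Fin n) (t : ℕ) : LocalState n V := r.state p t

/-- The snapshots that reach process `p` at time `t`. -/
def msgs (p : Fin n) (t : ℕ) : List (Fin n × Snapshot n V) :=
  (r.inbox p t).map fun d => (d.sender, d.msg)

variable {r} {p q j : Fin n} {s t : ℕ} {v w : V} {x : Snapshot n V}

theorem st_zero : st r p 0 = ⟨⟨r.proposal p, none, 0, 0, r.proposal p, none⟩, 0, fun _ => ∅⟩ :=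
  r.state_zero p

theorem step_eq (h : r.active p t) :
    (⟨st r p (t + 1), r.sent p t, r.output p t⟩ :
        StepResult n V (LocalState n V) (Snapshot n V)) =
      ⟨next e f Δ p (st r p t) (msgs r p t),
        fun _ => some (next e f Δ p (st r p t) (msgs r p t)).snap,
        if (st r p t).snap.dec = none then (next e f Δ p (st r p t) (msgs r p t)).snap.dec
        else none⟩ :=
  r.step_active p t h

theorem st_succ (h : r.active p t) :
    st r p (t + 1) = next e f Δ p (st r p t) (msgs r p t) :=
  congrArg StepResult.state (step_eq h)

theorem sent_eq (h : r.active p t) (q : Fin n) :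
    r.sent p t q = some (st r p (t + 1)).snap := by
  rw [st_succ h]
  exact congrFun (congrArg StepResult.send (step_eq h)) q

theorem output_eq (h : r.active p t) :
    r.output p t = if (st r p t).snap.dec = none then (st r p (t + 1)).snap.dec else none := by
  rw [st_succ h]
  exact congrArg StepResult.decision (step_eq h)

theorem st_idle (h : ¬ r.active p t) : st r p (t + 1) = st r p t :=
  (r.step_idle p t h).1

theorem active_of_sent {m : Snapshot n V} (h : r.sent p t q = some m) : r.active p t := by
  by_contra hna
  rw [(r.step_idle p t hna).2.1] at h
  cases h

theorem of_mem_msgs (h : (j, x) ∈ msgs r p t) : ∃ s ≤ t, x = (st r j s).snap := by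
  obtain ⟨d, hd, hx⟩ := List.mem_map.1 h
  obtain ⟨h1, h2⟩ := r.inbox_sent p t d hd
  obtain ⟨rfl, rfl⟩ := Prod.mk.inj hx
  refine ⟨d.sentAt + 1, h1, ?_⟩
  rw [sent_eq (active_of_sent h2)] at h2
  exact (Option.some.inj h2).symm

/-- A relation between consecutive states holds if it is reflexive and holds for every step. -/
theorem rel_succ (R : LocalState n V → LocalState n V → Prop) (hrefl : ∀ σ, R σ σ)
    (hnext : ∀ inbox, R (st r p t) (next e f Δ p (st r p t) inbox)) :
    R (st r p t) (st r p (t + 1)) := by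
  by_cases h : r.active p t
  · rw [st_succ h]
    exact hnext _
  · rw [st_idle h]
    exact hrefl _

theorem initVal_eq : (st r p t).snap.initVal = r.proposal p := by
  induction t with
  | zero => rw [st_zero]
  | succ t ih =>
    rw [← ih]
    exact rel_succ (fun σ σ' => σ'.snap.initVal = σ.snap.initVal) (fun _ => rfl) fun _ => rfl

theorem of_mem_heard (h : x ∈ (st r p t).heard j) : ∃ s ≤ t, x = (st r j s).snap := by
  induction t with
  | zero =>
    rw [st_zero] at h
    cases h
  | succ t ih =>
    by_cases ha : r.active p t
    · rw [st_succ ha] at h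
      rcases h with h | h
      · obtain ⟨s, hs, h⟩ := ih h
        exact ⟨s, by omega, h⟩
      · obtain ⟨s, hs, h⟩ := of_mem_msgs h
        exact ⟨s, by omega, h⟩
    · rw [st_idle ha] at h
      obtain ⟨s, hs, h⟩ := ih h
      exact ⟨s, by omega, h⟩

theorem of_mem_hear (h : x ∈ (st r p t).hear (msgs r p t) j) : ∃ s ≤ t, x = (st r j s).snap :=
  h.elim of_mem_heard of_mem_msgs

theorem bal_mono : Monotone fun t => (st r p t).snap.bal :=
  monotone_nat_of_le_succ fun _ =>
    rel_succ (fun σ σ' => σ.snap.bal ≤ σ'.snap.bal) (fun _ => le_rfl) fun _ => le_nextBal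

theorem vbal_mono : Monotone fun t => (st r p t).snap.vbal :=
  monotone_nat_of_le_succ fun t =>
    rel_succ (fun σ σ' => σ.snap.vbal ≤ σ'.snap.vbal) (fun _ => le_rfl) fun inbox => by
      change _ ≤ (nextAccepted e f Δ p (st r p t) inbox).1
      rcases nextAccepted_cases (e := e) (f := f) (Δ := Δ) (p := p) (σ := st r p t)
        (inbox := inbox) with h | h
      · rw [h]
      · omega

theorem vbal_le_bal : (st r p t).snap.vbal ≤ (st r p t).snap.bal := by
  induction t with
  | zero => rw [st_zero]
  | succ t ih =>
    refine rel_succ (r := r) (p := p) (t := t)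
      (fun σ σ' => σ.snap.vbal ≤ σ.snap.bal → σ'.snap.vbal ≤ σ'.snap.bal) (fun _ h => h)
      (fun inbox ih => ?_) ih
    change (nextAccepted e f Δ p (st r p t) inbox).1 ≤ nextBal Δ p (st r p t) inbox
    rcases nextAccepted_cases (e := e) (f := f) (Δ := Δ) (p := p) (σ := st r p t)
      (inbox := inbox) with h | h
    · rw [h]
      exact ih.trans le_nextBal
    · omega

theorem dec_persists (hst : s ≤ t) (h : (st r p s).snap.dec = some v) :
    (st r p t).snap.dec = some v := by
  induction t, hst using Nat.le_induction with
  | base => exact h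
  | succ t _ ih =>
    refine rel_succ (r := r) (p := p) (t := t)
      (fun σ σ' => σ.snap.dec = some v → σ'.snap.dec = some v) (fun _ h => h) (fun _ h => ?_) ih
    exact (nextDec_of_ne_none (by simp [h])).trans h

theorem vote_persists {y : Fin n × V} (hst : s ≤ t) (h : (st r p s).snap.vote = some y) :
    (st r p t).snap.vote = some y := by
  induction t, hst using Nat.le_induction with
  | base => exact h
  | succ t _ ih =>
    refine rel_succ (r := r) (p := p) (t := t)
      (fun σ σ' => σ.snap.vote = some y → σ'.snap.vote = some y) (fun _ h => h) (fun _ h => ?_) ih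
    exact (nextVote_eq (.inl (by simp [h]))).trans h

/-- A process that has joined a ballot does not vote any more. -/
theorem vote_frozen (h : 0 < (st r p s).snap.bal) {y : Fin n × V}
    (hv : (st r p t).snap.vote = some y) : (st r p s).snap.vote = some y := by
  rcases le_total t s with hts | hst
  · exact vote_persists hts hv
  · rw [← hv]
    clear hv
    induction t, hst using Nat.le_induction with
    | base => rfl
    | succ t hst ih =>
      rw [ih]
      refine rel_succ (r := r) (p := p) (t := t)
        (fun σ σ' => 0 < σ.snap.bal → σ.snap.vote = σ'.snap.vote) (fun _ _ => rfl)
        (fun _ hb => ?_) (h.trans_le (bal_mono hst))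
      exact (nextVote_eq (.inr (hb.trans_le le_nextBal).ne')).symm

/-- A process in ballot `b` accepts only in ballots from `b` on. -/
theorem vbal_frozen (hst : s ≤ t) :
    (st r p t).snap.vbal = (st r p s).snap.vbal ∨
      (st r p s).snap.bal ≤ (st r p t).snap.vbal := by
  induction t, hst using Nat.le_induction with
  | base => exact .inl rfl
  | succ t hst ih =>
    have hb : (st r p s).snap.bal ≤ (st r p t).snap.bal := bal_mono hst
    refine rel_succ (r := r) (p := p) (t := t)
      (fun σ σ' => (st r p s).snap.bal ≤ σ.snap.bal →
        (σ.snap.vbal = (st r p s).snap.vbal ∨ (st r p s).snap.bal ≤ σ.snap.vbal) →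
        (σ'.snap.vbal = (st r p s).snap.vbal ∨ (st r p s).snap.bal ≤ σ'.snap.vbal))
      (fun _ _ h => h) (fun inbox hb ih => ?_) hb ih
    change (nextAccepted e f Δ p (st r p t) inbox).1 = _ ∨
      _ ≤ (nextAccepted e f Δ p (st r p t) inbox).1
    rcases nextAccepted_cases (e := e) (f := f) (Δ := Δ) (p := p) (σ := st r p t)
      (inbox := inbox) with h | h
    · rw [h]
      exact ih
    · rw [h.2.1]
      exact .inr (hb.trans le_nextBal)

/-- The inequality keeps the proposer of a smaller value from voting for a larger one, which decides
the counting in `Proposed.eq_of_chosen`. -/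
theorem vote_spec (h : (st r p t).snap.vote = some (j, v)) :
    v = r.proposal j ∧ v ≤ r.proposal p := by
  induction t with
  | zero =>
    rw [st_zero] at h
    cases h
  | succ t ih =>
    by_cases ha : r.active p t
    · rw [st_succ ha] at h
      rcases nextVote_cases h with h | ⟨x, hx, rfl, hle⟩
      · exact ih h
      · rw [initVal_eq] at hle
        obtain ⟨s, -, rfl⟩ := of_mem_msgs hx
        exact ⟨initVal_eq, hle⟩
    · rw [st_idle ha] at h
      exact ih h

/-- In the run `r`, the leader of ballot `b` has proposed `v` after hearing from a quorum. -/
def Proposed (r : Run (gossip (V := V) n e f Δ) Δ) (b : ℕ) (v : V) : Prop :=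
  ∃ p t, b % n = (p : Fin n) ∧ (st r p t).snap.vbal < b ∧ (st r p (t + 1)).snap.vbal = b ∧
    (st r p (t + 1)).snap.vval = v ∧
    ∃ (Q : Finset (Fin n)) (s : Fin n → ℕ), n - f ≤ Q.card ∧
      (∀ q ∈ Q, (st r q (s q)).snap.bal = b ∧ (st r q (s q)).snap.vbal < b ∧
        (st r q (s q)).snap.dec = none) ∧
      Safe e f Q (fun q => (st r q (s q)).snap) (r.proposal p) v

theorem Safe.congr {Q : Finset (Fin n)} {y z : Fin n → Snapshot n V} {d v : V}
    (hyz : ∀ q ∈ Q, y q = z q) (h : Safe e f Q y d v) : Safe e f Q z d v := by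
  have hc : ∀ j v, Candidate e f Q y j v ↔ Candidate e f Q z j v := by
    intro j v
    refine and_congr_right fun _ => exists_congr fun G => and_congr_right fun hG =>
      and_congr_right fun _ => forall₂_congr fun q hq => by rw [hyz q (hG hq)]
  rcases h with ⟨q, hq, h1, h2, h3⟩ | ⟨h1, h2⟩
  · refine .inl ⟨q, hq, by rwa [← hyz q hq], by rwa [← hyz q hq], fun q' hq' => ?_⟩
    rw [← hyz q hq, ← hyz q' hq']
    exact h3 q' hq'
  · refine .inr ⟨fun q hq => by rw [← hyz q hq]; exact h1 q hq, ?_⟩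
    simpa only [hc] using h2

/-- An accepted value is either copied from an earlier acceptance in the same ballot or introduced
by the leader, so induction on time leads back to the leader. -/
theorem proposed_of_vbal (h : 0 < (st r p t).snap.vbal) :
    Proposed r (st r p t).snap.vbal (st r p t).snap.vval := by
  induction t using Nat.strong_induction_on generalizing p with
  | _ t ih =>
    cases t with
    | zero =>
      rw [st_zero] at h
      cases h
    | succ t =>
      by_cases ha : r.active p t
      swap
      · rw [st_idle ha] at h ⊢
        exact ih t t.lt_succ_self h
      have hst := st_succ ha
      rcases nextAccepted_cases (e := e) (f := f) (Δ := Δ) (p := p) (σ := st r p t)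
        (inbox := msgs r p t) with h1 | ⟨h1, h2, h3⟩
      · have e1 : (st r p (t + 1)).snap.vbal = (st r p t).snap.vbal := by
          rw [hst]
          exact congrArg Prod.fst h1
        have e2 : (st r p (t + 1)).snap.vval = (st r p t).snap.vval := by
          rw [hst]
          exact congrArg Prod.snd h1
        rw [e1] at h
        rw [e1, e2]
        exact ih t t.lt_succ_self h
      · have e1 : (st r p (t + 1)).snap.vbal = nextBal Δ p (st r p t) (msgs r p t) := by
          rw [hst]
          exact h2
        have e2 : (st r p (t + 1)).snap.vval
            = (nextAccepted e f Δ p (st r p t) (msgs r p t)).2 := by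
          rw [hst]
          rfl
        rw [← e1, ← e2] at h3
        rcases h3 with ⟨j, x, hx, hx1, hx2⟩ | ⟨h4, h5, Q, y, hQ, hy, hsafe⟩
        · obtain ⟨s, hs, rfl⟩ := of_mem_hear hx
          rw [← hx1, ← hx2]
          rw [← hx1] at h
          exact ih s (by omega) h
        · have : ∀ q, ∃ s, q ∈ Q → y q = (st r q s).snap := by
            intro q
            by_cases hq : q ∈ Q
            · obtain ⟨s, -, hs⟩ := of_mem_hear (hy q hq).1
              exact ⟨s, fun _ => hs⟩
            · exact ⟨0, fun h => absurd h hq⟩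
          choose s hs using this
          rw [← e1] at h1
          rw [initVal_eq] at hsafe
          refine ⟨p, t, h4, h1, rfl, rfl, Q, s, hQ, fun q hq => ?_, Safe.congr hs hsafe⟩
          rw [← hs q hq]
          refine ⟨(hy q hq).2.1, (hy q hq).2.2, ?_⟩
          -- A decision in a snapshot heard would make the leader decide in this very step, and a
          -- decided leader makes no proposal of its own.
          by_contra hd
          obtain ⟨w, hw⟩ := Option.ne_none_iff_exists'.1 hd
          exact nextDec_ne_none (.inl ⟨q, y q, (hy q hq).1, hw⟩) h5

/-- The ballot number determines the leader, whose `vbal` is monotone and so rises to `b` only once.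
-/
theorem Proposed.unique {b : ℕ} (h : Proposed r b v) (h' : Proposed r b w) : v = w := by
  obtain ⟨p, t, hp, h1, h2, h3, -⟩ := h
  obtain ⟨p', t', hp', h1', h2', h3', -⟩ := h'
  obtain rfl : p = p' := Fin.ext (hp.symm.trans hp')
  have ht : t = t' := by
    by_contra hne
    rcases lt_or_gt_of_ne hne with hlt | hlt
    · have : (st r p (t + 1)).snap.vbal ≤ (st r p t').snap.vbal := vbal_mono hlt
      omega
    · have : (st r p (t' + 1)).snap.vbal ≤ (st r p t).snap.vbal := vbal_mono hlt
      omega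
  subst ht
  rw [← h3, ← h3']

/-- In the run `r`, the value `v` is chosen in ballot `b`, where ballot `0` stands for the
votes on proposals. -/
def Chosen (r : Run (gossip (V := V) n e f Δ) Δ) (b : ℕ) (v : V) : Prop :=
  (b = 0 ∧ ∃ p, v = r.proposal p ∧
    (∃ t, (st r p t).snap.bal = 0 ∧ (st r p t).snap.dec ≠ none) ∧
    ∃ F : Finset (Fin n), n - e ≤ F.card ∧
      ∀ q ∈ F, ∃ t, (st r q t).snap.vote = some (p, v)) ∨
  (0 < b ∧ ∃ Q : Finset (Fin n), n - f ≤ Q.card ∧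
    ∀ q ∈ Q, ∃ t, (st r q t).snap.vbal = b ∧ (st r q t).snap.vval = v)

theorem chosen_of_dec (h : (st r p t).snap.dec = some v) : ∃ b, Chosen r b v := by
  induction t using Nat.strong_induction_on generalizing p with
  | _ t ih =>
    cases t with
    | zero =>
      rw [st_zero] at h
      cases h
    | succ t =>
      by_cases ha : r.active p t
      swap
      · rw [st_idle ha] at h
        exact ih t t.lt_succ_self h
      by_cases h0 : (st r p t).snap.dec = none
      swap
      · obtain ⟨w, hw⟩ := Option.ne_none_iff_exists'.1 h0
        rw [dec_persists t.le_succ hw] at h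
        exact ih t t.lt_succ_self (hw.trans h)
      have hst := st_succ ha
      have h' : nextDec e f Δ p (st r p t) (msgs r p t) = some v := by
        rw [← h, hst]
        rfl
      rcases canDecide_of_nextDec h0 h' with ⟨j, x, hx, hd⟩ | ⟨hb, rfl, F, hF, hv⟩ |
        ⟨b, hb, Q, hQ, hv⟩
      · obtain ⟨s, hs, rfl⟩ := of_mem_hear hx
        exact ih s (by omega) hd
      · refine ⟨0, .inl ⟨rfl, p, initVal_eq, ⟨t + 1, ?_, by simp [h]⟩, F, hF, fun q hq => ?_⟩⟩
        · rw [hst]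
          exact hb
        · obtain ⟨x, hx, hv⟩ := hv q hq
          obtain ⟨s, -, rfl⟩ := of_mem_hear hx
          exact ⟨s, hv⟩
      · refine ⟨b, .inr ⟨hb, Q, hQ, fun q hq => ?_⟩⟩
        obtain ⟨x, hx, hv⟩ := hv q hq
        obtain ⟨s, -, rfl⟩ := of_mem_hear hx
        exact ⟨s, hv⟩

theorem dec_of_decidesAt (h : r.DecidesAt p v t) : (st r p (t + 1)).snap.dec = some v := by
  by_cases ha : r.active p t
  · rw [Run.DecidesAt, output_eq ha] at h
    split_ifs at h
    exact h
  · rw [Run.DecidesAt, (r.step_idle p t ha).2.2.1] at h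
    cases h

theorem exists_decidesAt (h : (st r p t).snap.dec ≠ none) : ∃ v s, s < t ∧ r.DecidesAt p v s := by
  induction t with
  | zero =>
    rw [st_zero] at h
    exact absurd rfl h
  | succ t ih =>
    by_cases h0 : (st r p t).snap.dec = none
    · have ha : r.active p t := by
        by_contra ha
        rw [st_idle ha] at h
        exact h h0
      obtain ⟨v, hv⟩ := Option.ne_none_iff_exists'.1 h
      exact ⟨v, t, t.lt_succ_self, by rw [Run.DecidesAt, output_eq ha, if_pos h0, hv]⟩
    · obtain ⟨v, s, hs, h⟩ := ih h0
      exact ⟨v, s, by omega, h⟩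

end Basic

/-! ### Agreement and validity -/

section Safety

variable [LinearOrder V] {r : Run (gossip (V := V) n e f Δ) Δ} {v w : V}

theorem exists_common {a b : ℕ} {A B : Finset (Fin n)} (hA : a ≤ A.card) (hB : b ≤ B.card) :
    a + b - n ≤ (A ∩ B).card := by
  have h1 := Finset.card_union_add_card_inter A B
  have h2 := Finset.card_le_univ (A ∪ B)
  rw [Fintype.card_fin] at h2
  omega

/-- Strong induction on the later ballot. For a positive ballot `b` this is the quorum intersection
argument of Paxos; ballot 0 needs the count of votes. -/
theorem Proposed.eq_of_chosen (hef : e ≤ f) (hf : 2 * f + 1 ≤ n) (he : 2 * e + f ≤ n) {b b' : ℕ}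
    (hb : b < b') (hp : Proposed r b' v) (hc : Chosen r b w) : v = w := by
  induction b' using Nat.strong_induction_on generalizing v with
  | _ b' ih =>
    obtain ⟨l, -, -, -, -, -, Q, s, hQ, hq, hsafe⟩ := hp
    rcases hsafe with ⟨m, hm, hm0, rfl, hmax⟩ | ⟨hz, hsafe⟩
    · have hprop := proposed_of_vbal hm0
      by_cases hlt : b < (st r m (s m)).snap.vbal
      · exact ih _ (hq m hm).2.1 hlt hprop
      rcases hc with ⟨rfl, -⟩ | ⟨hb0, B, hB, hv⟩
      · exact absurd hm0 hlt
      obtain ⟨q, hqm⟩ : (Q ∩ B).Nonempty := by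
        have := exists_common hQ hB
        exact Finset.card_pos.1 (by omega)
      obtain ⟨hqQ, hqB⟩ := Finset.mem_inter.1 hqm
      obtain ⟨t, ht, rfl⟩ := hv q hqB
      -- `q` accepted in `b` before its snapshot: afterwards it is in ballot `b' > b`, where new
      -- acceptances have number at least `b'`.
      have hle : b ≤ (st r q (s q)).snap.vbal := by
        rcases le_total t (s q) with hts | hst
        · rw [← ht]
          exact vbal_mono hts
        · rcases vbal_frozen (r := r) (p := q) hst with h | h
          · omega
          · have := (hq q hqQ).1
            omega
      have hle' := hmax q hqQ
      simp only at hle' hlt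
      have hmb : (st r m (s m)).snap.vbal = b := by omega
      rw [hmb, ← ht] at hprop
      exact hprop.unique (proposed_of_vbal (by omega))
    · rcases hc with ⟨rfl, p, rfl, ⟨t, htb, htd⟩, F, hF, hv⟩ | ⟨hb0, B, hB, hv⟩
      -- `p` decided while in ballot 0, so its snapshot in ballot `b'` would show a decision, but
      -- the quorum's snapshots show none.
      · have hpQ : p ∉ Q := by
          intro hpQ
          obtain ⟨d, hd⟩ := Option.ne_none_iff_exists'.1 htd
          rcases le_total t (s p) with hts | hst
          · have := dec_persists hts hd
            rw [(hq p hpQ).2.2] at this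
            cases this
          · have : (st r p (s p)).snap.bal ≤ (st r p t).snap.bal := bal_mono hst
            have := (hq p hpQ).1
            omega
        have hvote : ∀ q ∈ Q, q ∈ F → (st r q (s q)).snap.vote = some (p, r.proposal p) := by
          intro q hqQ hqF
          obtain ⟨t, ht⟩ := hv q hqF
          exact vote_frozen (by rw [(hq q hqQ).1]; exact hb) ht
        have hcand : Candidate e f Q (fun q => (st r q (s q)).snap) p (r.proposal p) := by
          have h1 := exists_common hQ hF
          exact ⟨hpQ, Q ∩ F, Finset.inter_subset_left, by omega, fun q hqm =>
            hvote q (Finset.mem_inter.1 hqm).1 (Finset.mem_inter.1 hqm).2⟩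
        rcases hsafe with ⟨⟨j, hj, G, hGQ, hcard, hGv⟩, hmin⟩ | ⟨hno, -⟩
        swap
        · exact absurd hcand (hno _ _)
        refine (hmin _ _ hcand).eq_of_not_lt fun hlt => ?_
        have hvj : v = r.proposal j := by
          obtain ⟨q, hq⟩ : G.Nonempty := Finset.card_pos.1 (by omega)
          exact (vote_spec (hGv q hq)).1
        have hjF : j ∉ F := by
          intro hjF
          obtain ⟨t, ht⟩ := hv j hjF
          have := (vote_spec ht).2
          rw [← hvj] at this
          exact absurd hlt this.not_gt
        have hGF : ∀ q ∈ G, q ∉ F := by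
          intro q hqG hqF
          have h1 := hvote q (hGQ hqG) hqF
          rw [hGv q hqG] at h1
          simp only [Option.some.injEq, Prod.mk.injEq] at h1
          exact hlt.ne h1.2
        -- A smaller candidate would put its proposer and its n - f - e voters, all distinct,
        -- outside `F`. Then n - f - e + 1 ≤ e, against 2e + f ≤ n.
        have hsub : insert j G ⊆ Fᶜ := by
          intro q hq
          rw [Finset.mem_compl]
          rcases Finset.mem_insert.1 hq with rfl | hq
          · exact hjF
          · exact hGF q hq
        have hle := Finset.card_le_card hsub
        rw [Finset.card_insert_of_notMem fun h => hj (hGQ h), Finset.card_compl,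
          Fintype.card_fin] at hle
        omega
      · obtain ⟨q, hqm⟩ : (Q ∩ B).Nonempty := by
          have := exists_common hQ hB
          exact Finset.card_pos.1 (by omega)
        obtain ⟨hqQ, hqB⟩ := Finset.mem_inter.1 hqm
        obtain ⟨t, ht, rfl⟩ := hv q hqB
        exfalso
        have h0 := hz q hqQ
        simp only at h0
        rcases le_total t (s q) with hts | hst
        · have : (st r q t).snap.vbal ≤ (st r q (s q)).snap.vbal := vbal_mono hts
          omega
        · rcases vbal_frozen (r := r) (p := q) hst with h | h
          · omega
          · have := (hq q hqQ).1
            omega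

theorem Chosen.proposed (hfn : f < n) {b : ℕ} (hb : 0 < b) (h : Chosen r b v) :
    Proposed r b v := by
  rcases h with ⟨rfl, -⟩ | ⟨-, Q, hQ, h⟩
  · omega
  · obtain ⟨q, hq⟩ : Q.Nonempty := Finset.card_pos.1 (by omega)
    obtain ⟨t, rfl, rfl⟩ := h q hq
    exact proposed_of_vbal hb

/-- Different ballots are handled by `Proposed.eq_of_chosen`. Within ballot 0, two sets of n - e
voters meet, and nobody votes twice. -/
theorem Chosen.unique (hef : e ≤ f) (hf : 2 * f + 1 ≤ n) (he : 2 * e + f ≤ n) {b b' : ℕ}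
    (h : Chosen r b v) (h' : Chosen r b' w) : v = w := by
  rcases lt_trichotomy b b' with hlt | rfl | hlt
  · exact ((h'.proposed (by omega) (by omega)).eq_of_chosen hef hf he hlt h).symm
  · rcases Nat.eq_zero_or_pos b with rfl | hb
    · rcases h with ⟨-, p, -, -, F, hF, hv⟩ | ⟨h, -⟩
      swap
      · omega
      rcases h' with ⟨-, p', -, -, F', hF', hv'⟩ | ⟨h, -⟩
      swap
      · omega
      obtain ⟨q, hq⟩ : (F ∩ F').Nonempty := by
        have := exists_common hF hF'
        exact Finset.card_pos.1 (by omega)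
      obtain ⟨hq, hq'⟩ := Finset.mem_inter.1 hq
      obtain ⟨t, ht⟩ := hv q hq
      obtain ⟨t', ht'⟩ := hv' q hq'
      have h1 := vote_persists (le_max_left t t') ht
      rw [vote_persists (le_max_right t t') ht'] at h1
      simp only [Option.some.injEq, Prod.mk.injEq] at h1
      exact h1.2.symm
    · exact (h.proposed (by omega) hb).unique (h'.proposed (by omega) hb)
  · exact (h.proposed (by omega) (by omega)).eq_of_chosen hef hf he hlt h'

theorem agreement (hef : e ≤ f) (hf : 2 * f + 1 ≤ n) (he : 2 * e + f ≤ n) : r.Agreement := by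
  intro p v t p' v' t' h h'
  obtain ⟨b, hb⟩ := chosen_of_dec (dec_of_decidesAt h)
  obtain ⟨b', hb'⟩ := chosen_of_dec (dec_of_decidesAt h')
  exact hb.unique hef hf he hb'

theorem Proposed.exists_proposal (hef : e ≤ f) (hf : 2 * f + 1 ≤ n) {b : ℕ}
    (h : Proposed r b v) : ∃ q, r.proposal q = v := by
  induction b using Nat.strong_induction_on generalizing v with
  | _ b ih =>
    obtain ⟨p, -, -, -, -, -, Q, s, hQ, hq, hsafe⟩ := h
    rcases hsafe with ⟨m, hm, hm0, rfl, -⟩ | ⟨-, ⟨⟨j, -, G, -, hG, hj⟩, -⟩ | ⟨-, rfl⟩⟩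
    · exact ih _ (hq m hm).2.1 (proposed_of_vbal hm0)
    · obtain ⟨q, hq⟩ := Finset.card_pos.1 (lt_of_lt_of_le (by omega) hG)
      exact ⟨j, (vote_spec (hj q hq)).1.symm⟩
    · exact ⟨p, rfl⟩

theorem validity (hef : e ≤ f) (hf : 2 * f + 1 ≤ n) : r.Validity := by
  intro p v t h
  obtain ⟨b, hb⟩ := chosen_of_dec (dec_of_decidesAt h)
  rcases Nat.eq_zero_or_pos b with rfl | hb0
  · rcases hb with ⟨-, p, h, -⟩ | ⟨h, -⟩
    · exact ⟨p, h.symm⟩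
    · omega
  · exact (hb.proposed (by omega) hb0).exists_proposal hef hf

end Safety

end Gossip

end TwoStepConsensus
namespace TwoStepConsensus

variable {n : ℕ} {V : Type u}

open LocalState

namespace Gossip

variable {e f Δ : ℕ}

/-! ### Clocks, ballots and message delivery after stabilization -/

section Progress

variable [LE V] {r : Run (gossip (V := V) n e f Δ) Δ} {p q j : Fin n} {s t : ℕ} {v w : V}
  {x : Snapshot n V}

theorem clock_le : (st r p t).clock ≤ t := by
  induction t with
  | zero => rw [st_zero]
  | succ t ih =>
    refine rel_succ (r := r) (p := p) (t := t)
      (fun σ σ' => σ.clock ≤ t → σ'.clock ≤ t + 1) (fun _ h => by omega) (fun _ h => ?_) ih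
    exact Nat.succ_le_succ h

/-- Local clocks never run ahead of real time, so no ballot exists before its scheduled start. This
both protects the first two rounds and isolates late ballots. -/
theorem bal_le : (st r p t).snap.bal ≤ Nat.sqrt t - (2 * Δ + 2) := by
  induction t using Nat.strong_induction_on generalizing p with
  | _ t ih =>
    cases t with
    | zero =>
      rw [st_zero]
      exact Nat.zero_le _
    | succ t =>
      have mono : ∀ s ≤ t + 1, Nat.sqrt s - (2 * Δ + 2) ≤ Nat.sqrt (t + 1) - (2 * Δ + 2) :=
        fun s hs => Nat.sub_le_sub_right (Nat.sqrt_le_sqrt hs) _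
      have hold : (st r p t).snap.bal ≤ Nat.sqrt (t + 1) - (2 * Δ + 2) :=
        (ih t t.lt_succ_self).trans (mono t t.le_succ)
      by_cases ha : r.active p t
      · rw [st_succ ha]
        refine max_le (max_le hold (foldr_max_le fun b hb => ?_)) ?_
        · obtain ⟨⟨j, x⟩, hm, rfl⟩ := List.mem_map.1 hb
          obtain ⟨s, hs, rfl⟩ := of_mem_msgs hm
          exact (ih s (by omega)).trans (mono s (by omega))
        · have := mono _ (Nat.succ_le_succ (clock_le (r := r) (p := p) (t := t)))
          rw [ballotAt]
          split_ifs
          · exact this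
          · exact Nat.zero_le _
      · rw [st_idle ha]
        exact hold

theorem ballotAt_le_bal (h : r.active p t) :
    ballotAt Δ p (st r p (t + 1)).clock ≤ (st r p (t + 1)).snap.bal := by
  rw [st_succ h]
  exact le_max_right _ _

theorem clock_succ (h : r.active p t) : (st r p (t + 1)).clock = (st r p t).clock + 1 := by
  rw [st_succ h]
  rfl

theorem heard_mono (hst : s ≤ t) : (st r p s).heard j ⊆ (st r p t).heard j := by
  induction t, hst using Nat.le_induction with
  | base => exact subset_rfl
  | succ t _ ih =>
    exact ih.trans (rel_succ (fun σ σ' => σ.heard j ⊆ σ'.heard j) (fun _ => subset_rfl)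
      fun _ _ hx => .inl hx)

theorem mem_heard_of_msgs (h : r.active p t) (hx : (j, x) ∈ msgs r p t) :
    x ∈ (st r p (t + 1)).heard j := by
  rw [st_succ h]
  exact .inr hx

theorem dec_ne_none (h : r.active p t)
    (hv : CanDecide e f p (r.proposal p) (st r p (t + 1)).snap.bal (st r p (t + 1)).heard v) :
    (st r p (t + 1)).snap.dec ≠ none := by
  rw [st_succ h] at hv ⊢
  rw [← initVal_eq (t := t)] at hv
  exact nextDec_ne_none hv

theorem vbal_eq_bal (h : r.active p t) (hlt : (st r p t).snap.vbal < (st r p (t + 1)).snap.bal)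
    (hv : CanAccept e f p (r.proposal p) (st r p (t + 1)).snap.bal (st r p (t + 1)).snap.dec
      (st r p (t + 1)).heard v) :
    (st r p (t + 1)).snap.vbal = (st r p (t + 1)).snap.bal := by
  rw [st_succ h] at hlt hv ⊢
  rw [← initVal_eq (t := t)] at hv
  exact nextAccepted_fst hlt hv

/-- After stabilization, every snapshot of a correct process reaches the correct processes in
time. -/
theorem mem_heard (hp : r.Correct p) (hq : r.Correct q) (hs : r.gst ≤ s) (ht : s + Δ + 1 ≤ t) :
    (st r p (s + 1)).snap ∈ (st r q t).heard p ∧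
      (st r p (s + 1)).snap.bal ≤ (st r q t).snap.bal := by
  have act : ∀ p, r.Correct p → ∀ s, r.gst ≤ s → r.active p s := fun p hp s hs =>
    r.prompt p s hs (by rw [show r.crash p = ⊤ from hp]; exact ENat.natCast_lt_top s)
  obtain ⟨t', ht'⟩ := r.reliable p q s _ hp hq (sent_eq (act p hp s hs) q)
  have h1 := (r.inbox_sent _ _ _ ht').1
  have h2 := r.delay_le _ _ _ ht'
  simp only at h1 h2
  have hact := act q hq t' (by omega)
  have hm : (p, (st r p (s + 1)).snap) ∈ msgs r q t' := List.mem_map.2 ⟨_, ht', rfl⟩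
  have hle : t' + 1 ≤ t := by omega
  refine ⟨heard_mono hle (mem_heard_of_msgs hact hm), le_trans ?_ (bal_mono hle)⟩
  change _ ≤ (st r q (t' + 1)).snap.bal
  rw [st_succ hact]
  exact le_nextBal_of_mem hm

end Progress

/-! ### Termination -/

section Termination

variable [LinearOrder V] [WellFoundedLT V] {r : Run (gossip (V := V) n e f Δ) Δ} {p q : Fin n}

/-- If after stabilization the correct process `l` leads ballot `m`, and no process joins a later
ballot for some time, then all correct processes decide. -/
theorem dec_of_isolated_ballot (hfn : f < n) (hr : {p | ¬ r.Correct p}.ncard ≤ f) {l : Fin n}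
    (hl : r.Correct l) {m t : ℕ} (hm : 0 < m) (hml : m % n = l) (ht : r.gst ≤ t)
    (hlead : m ≤ (st r l t).snap.bal)
    (hiso : ∀ p, ∀ s ≤ t + 5 * Δ + 9, (st r p s).snap.bal ≤ m) (hp : r.Correct p) :
    ∃ s, (st r p s).snap.dec ≠ none := by
  classical
  have act : ∀ {p s}, r.Correct p → t ≤ s → r.active p s := fun {p s} hp hs =>
    r.prompt p s (ht.trans hs) (by rw [show r.crash p = ⊤ from hp]; exact ENat.natCast_lt_top s)
  set Q : Finset (Fin n) := Finset.univ.filter fun p => r.Correct p with hQdef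
  have hQ : n - f ≤ Q.card := by
    have h : {p | ¬ r.Correct p} = ((Qᶜ : Finset (Fin n)) : Set (Fin n)) := by
      ext p
      simp [hQdef]
    rw [h, Set.ncard_coe_finset, Finset.card_compl, Fintype.card_fin] at hr
    omega
  have mem_Q : ∀ {q}, q ∈ Q ↔ r.Correct q := fun {q} => by simp [hQdef]
  have hQne : Q.Nonempty := ⟨l, mem_Q.2 hl⟩
  have hbal : ∀ q, r.Correct q → ∀ s, t + Δ + 1 ≤ s → s ≤ t + 5 * Δ + 9 →
      (st r q s).snap.bal = m := by
    intro q hq s h1 h2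
    refine le_antisymm (hiso q s h2) ?_
    exact (hlead.trans (bal_mono t.le_succ)).trans (mem_heard hl hq ht h1).2
  have hvbal : ∀ {q s s'}, r.Correct q → t + Δ + 1 ≤ s' → s' ≤ t + 5 * Δ + 9 → s ≤ s' →
      m ≤ (st r q s).snap.vbal → (st r q s').snap.vbal = m := by
    intro q s s' hq h1 h2 hs h
    have h3 : (st r q s).snap.vbal ≤ (st r q s').snap.vbal := vbal_mono hs
    have h4 := vbal_le_bal (r := r) (p := q) (t := s')
    rw [hbal q hq s' h1 h2] at h4
    omega
  have accept : ∀ {q s}, r.Correct q → t + Δ + 1 ≤ s → s + 1 ≤ t + 5 * Δ + 9 →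
      (∃ v, CanAccept e f q (r.proposal q) m (st r q (s + 1)).snap.dec
        (st r q (s + 1)).heard v) → (st r q (s + 1)).snap.vbal = m := by
    rintro q s hq h1 h2 ⟨v, hv⟩
    have hb := hbal q hq (s + 1) (by omega) h2
    by_cases hlt : (st r q s).snap.vbal < m
    · rw [← hb] at hlt hv
      rw [vbal_eq_bal (act hq (by omega)) hlt hv, hb]
    · exact hvbal hq (by omega) h2 s.le_succ (by omega)
  -- At `a` the leader has heard from all correct processes in ballot `m`; at `b` they have its
  -- accepted value, and at `c` each other's acceptances. This ends by `t + 4 * Δ + 7`, within the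
  -- window with room to spare.
  obtain ⟨a, ha⟩ : ∃ a, a = t + 2 * Δ + 2 := ⟨_, rfl⟩
  have hleader : (st r l (a + 1)).snap.dec ≠ none ∨ (st r l (a + 1)).snap.vbal = m := by
    by_cases hd : (st r l (a + 1)).snap.dec = none
    swap
    · exact .inl hd
    refine .inr (accept hl (by omega) (by omega) ?_)
    by_cases hx : ∃ v j, ∃ x ∈ (st r l (a + 1)).heard j, x.vbal = m ∧ x.vval = v
    · obtain ⟨v, hx⟩ := hx
      exact ⟨v, .inl hx⟩
    · obtain ⟨v, hv⟩ := exists_safe (e := e) (f := f) hQne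
        (fun q => (st r q (t + Δ + 1 + 1)).snap) (r.proposal l)
      refine ⟨v, .inr ⟨hml, hd, Q, _, hQ, fun q hq => ?_, hv⟩⟩
      have hq := mem_Q.1 hq
      have h1 := (mem_heard hq hl (s := t + Δ + 1) (t := a + 1) (by omega) (by omega)).1
      have h2 := hbal q hq (t + Δ + 1 + 1) (by omega) (by omega)
      refine ⟨h1, h2, lt_of_le_of_ne (h2 ▸ vbal_le_bal) fun h => hx ⟨_, q, _, h1, h, rfl⟩⟩
  by_cases hd : (st r l (a + 1)).snap.dec = none
  · have hvl := hleader.resolve_left (not_not.2 hd)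
    obtain ⟨b, hb⟩ : ∃ b, b = a + Δ + 2 := ⟨_, rfl⟩
    have hacc : ∀ q, r.Correct q → (st r q (b + 1)).snap.vbal = m := by
      intro q hq
      refine accept hq (by omega) (by omega) ⟨_, .inl ⟨l, _, (mem_heard hl hq (s := a + 1)
        (t := b + 1) (by omega) (by omega)).1, ?_, rfl⟩⟩
      exact hvbal hl (by omega) (by omega) (a + 1).le_succ hvl.ge
    obtain ⟨c, hc⟩ : ∃ c, c = b + Δ + 2 := ⟨_, rfl⟩
    have hacc' : ∀ q, r.Correct q → (st r q (b + 1 + 1)).snap.vbal = m := fun q hq =>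
      hvbal hq (by omega) (by omega) (b + 1).le_succ (hacc q hq).ge
    refine ⟨c + 1, dec_ne_none (v := (st r l (b + 1 + 1)).snap.vval) (act hp (by omega))
      (.inr (.inr ⟨m, hm, Q, hQ, fun q hq => ?_⟩))⟩
    have hq := mem_Q.1 hq
    refine ⟨_, (mem_heard hq hp (s := b + 1) (t := c + 1) (by omega) (by omega)).1,
      hacc' q hq, ?_⟩
    have h1 := proposed_of_vbal (r := r) (p := q) (t := b + 1 + 1) (by rw [hacc' q hq]; exact hm)
    have h2 := proposed_of_vbal (r := r) (p := l) (t := b + 1 + 1) (by rw [hacc' l hl]; exact hm)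
    rw [hacc' q hq] at h1
    rw [hacc' l hl] at h2
    exact h1.unique h2
  · obtain ⟨v, hv⟩ := Option.ne_none_iff_exists'.1 hd
    exact ⟨a + Δ + 2 + 1, dec_ne_none (act hp (by omega)) (.inl ⟨l, _, (mem_heard hl hp
      (s := a + 1) (t := a + Δ + 2 + 1) (by omega) (by omega)).1,
      dec_persists (a + 1).le_succ hv⟩)⟩

/-- After stabilization a correct clock lags behind real time by a constant at most `gst`, while the
gaps between squares grow. A late ballot led by `p` therefore starts long before the next one can.
-/
theorem termination (hfn : f < n) (hr : {p | ¬ r.Correct p}.ncard ≤ f) : r.Termination := by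
  intro p hp
  have act : ∀ s, r.gst ≤ s → r.active p s := fun s hs =>
    r.prompt p s hs (by rw [show r.crash p = ⊤ from hp]; exact ENat.natCast_lt_top s)
  have hclock : ∀ k, (st r p (r.gst + k)).clock = (st r p r.gst).clock + k := by
    intro k
    induction k with
    | zero => rfl
    | succ k ih => rw [← Nat.add_assoc, clock_succ (act _ (by omega)), ih, Nat.add_assoc]
  have hn : 0 < n := by omega
  obtain ⟨m, hm, hmp⟩ : ∃ m, r.gst + 5 * Δ + 10 ≤ m ∧ m % n = p := by
    refine ⟨n * (r.gst + 5 * Δ + 10) + p, ?_, ?_⟩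
    · exact (Nat.le_mul_of_pos_left _ hn).trans (Nat.le_add_right _ _)
    · rw [Nat.mul_add_mod, Nat.mod_eq_of_lt p.2]
  set N := (m + (2 * Δ + 2)) * (m + (2 * Δ + 2)) with hN
  have hmN : m ≤ N := (Nat.le_add_right _ _).trans (Nat.le_mul_self _)
  have hc := clock_le (r := r) (p := p) (t := r.gst)
  obtain ⟨k, hk⟩ : ∃ k, (st r p r.gst).clock + (k + 1) = N :=
    ⟨N - (st r p r.gst).clock - 1, by omega⟩
  have hlead : m ≤ (st r p (r.gst + k + 1)).snap.bal := by
    have h1 := ballotAt_le_bal (act (r.gst + k) (by omega))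
    rw [Nat.add_assoc, hclock, hk, ballotAt, hN, Nat.sqrt_eq, Nat.add_sub_cancel, if_pos hmp] at h1
    exact h1
  -- Ballot `m` starts by time `N + gst`, and the next square after `N` is `N + 2 * (m + (2 * Δ +
  -- 2)) + 1`; the choice `m ≥ gst + 5 * Δ + 10` leaves the required gap.
  have hiso : ∀ q, ∀ s ≤ r.gst + k + 1 + 5 * Δ + 9, (st r q s).snap.bal ≤ m := by
    refine fun q s hs => bal_le.trans ?_
    have : Nat.sqrt s < m + (2 * Δ + 2) + 1 := by
      rw [Nat.sqrt_lt]
      have : (m + (2 * Δ + 2) + 1) * (m + (2 * Δ + 2) + 1) = N + 2 * (m + (2 * Δ + 2)) + 1 := by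
        rw [hN]
        ring
      omega
    omega
  obtain ⟨s, hs⟩ := dec_of_isolated_ballot (t := r.gst + k + 1) hfn hr hp (by omega) hmp (by omega)
    hlead hiso hp
  obtain ⟨v, s, -, h⟩ := exists_decidesAt hs
  exact ⟨v, s, h⟩

end Termination

/-! ### Two-step decisions -/

section TwoStep

variable [LinearOrder V]

theorem exists_fast_run (hΔ : 0 < Δ) {E : Finset (Fin n)} (hE : E.card = e) (I : Fin n → V)
    {p : Fin n} (hp : p ∉ E) (hmin : ∀ q, q ∉ E → I p ≤ I q) :
    ∃ r : Run (gossip (V := V) n e f Δ) Δ,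
      r.proposal = I ∧ r.FaultySynchronous E ∧ r.TwoStepFor p := by
  -- Messages of `p` arrive first. Its proposal is least outside `E`, so every correct process, `p`
  -- included, votes for it at time Δ, and these n - e votes reach `p` at time 2Δ.
  have hL : (p :: (Finset.univ.erase p).toList).Nodup :=
    List.nodup_cons.2 ⟨by simp, Finset.nodup_toList _⟩
  have hmem : ∀ q, q ∈ p :: (Finset.univ.erase p).toList := by
    intro q
    by_cases h : q = p <;> simp [h]
  set S := Schedule.sync hΔ E _ hL hmem with hS
  set r := S.run (gossip (V := V) n e f Δ) I with hr
  have hsync : r.FaultySynchronous E := Schedule.sync_faultySynchronous _ I hΔ E _ hL hmem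
  refine ⟨r, rfl, hsync, ?_⟩
  -- The offset `2 * Δ + 2` in the ballot timer serves this: ballot 0 is still current after the
  -- step at time 2Δ.
  have hbal : ∀ q, ∀ t ≤ 2 * Δ + 1, (st r q t).snap.bal = 0 := by
    intro q t ht
    have h1 := bal_le (r := r) (p := q) (t := t)
    have h2 := (Nat.sqrt_le_self t)
    omega
  have hact : ∀ q, q ∉ E → ∀ t, r.active q t := fun q hq t => hsync.instantaneous q t hq
  have hnone : ∀ q, q ∉ E → ∀ t ≤ Δ, (st r q t).snap.vote = none := by
    intro q hq t ht
    induction t with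
    | zero => rw [st_zero]
    | succ t ih =>
      have hdel : S.deliv q t = [] := by
        refine if_neg fun h => ?_
        have := Nat.le_of_dvd h.2.1 h.2.2
        omega
      have hmsgs : msgs r q t = [] := by
        rw [msgs, hr, Schedule.run_inbox, hdel]
        rfl
      rw [st_succ (hact q hq t), hmsgs]
      change nextVote _ _ _ = none
      rw [nextVote]
      split_ifs
      · rfl
      · exact ih (by omega)
  have hvote : ∀ q, q ∉ E → (st r q (Δ + 1)).snap.vote = some (p, I p) := by
    intro q hq
    obtain ⟨l, hl⟩ : ∃ l, S.deliv q Δ = (p, 0) :: l := by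
      obtain ⟨k, rfl⟩ := Nat.exists_eq_succ_of_ne_zero hΔ.ne'
      have h : S.deliv q (k + 1) = (p :: (Finset.univ.erase p).toList) ×ˢ
          List.range' (k + 1 - (k + 1)) (k + 1) := if_pos ⟨hq, hΔ, dvd_rfl⟩
      rw [Nat.sub_self, List.range'_succ] at h
      exact ⟨_, h⟩
    obtain ⟨l', hl'⟩ : ∃ l', msgs r q Δ = (p, (st r p 1).snap) :: l' := by
      rw [msgs, hr, Schedule.run_inbox, hl, packets, List.filterMap_cons]
      simp only [← hr, sent_eq (hact p hp 0) q]
      exact ⟨_, rfl⟩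
    rw [st_succ (hact q hq Δ), hl']
    change nextVote _ _ _ = _
    have hb : nextBal Δ q (st r q Δ) ((p, (st r p 1).snap) :: l') = 0 := by
      have := hbal q (Δ + 1) (by omega)
      rwa [st_succ (hact q hq Δ), hl'] at this
    rw [nextVote, if_pos ⟨hnone q hq Δ le_rfl, hb⟩, List.find?_cons_of_pos, Option.map_some,
      initVal_eq]
    · rfl
    · rw [initVal_eq, initVal_eq]
      have h : r.proposal p ≤ r.proposal q := hmin q hq
      simpa using h
  have hdec : (st r p (2 * Δ + 1)).snap.dec ≠ none := by
    refine dec_ne_none (v := I p) (hact p hp _) (.inr (.inl ⟨hbal p _ le_rfl, rfl, Eᶜ, ?_,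
      fun q hq => ⟨(st r q (Δ + 1)).snap, ?_, hvote q (Finset.mem_compl.1 hq)⟩⟩))
    · rw [Finset.card_compl, Fintype.card_fin, hE]
    · have hq := Finset.mem_compl.1 hq
      have h := hsync.delivery q p Δ _ hp (sent_eq (hact q hq Δ) p)
      rw [Nat.div_self hΔ] at h
      exact mem_heard_of_msgs (hact p hp _) (List.mem_map.2 ⟨_, h, rfl⟩)
  obtain ⟨v, s, hs, h⟩ := exists_decidesAt hdec
  exact ⟨v, s, by omega, h⟩

theorem twoStep (hΔ : 0 < Δ) (hen : e < n) : (gossip (V := V) n e f Δ).TwoStep Δ e := by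
  intro E hE
  refine ⟨fun I => ?_, fun I ⟨v, hv⟩ p hp => ?_⟩
  · have hne : (Eᶜ : Finset (Fin n)).Nonempty := by
      refine Finset.card_pos.1 ?_
      rw [Finset.card_compl, Fintype.card_fin]
      omega
    obtain ⟨p, hp, hmin⟩ := Eᶜ.exists_min_image I hne
    obtain ⟨r, h1, h2, h3⟩ := exists_fast_run (f := f) hΔ hE I (Finset.mem_compl.1 hp)
      fun q hq => hmin q (Finset.mem_compl.2 hq)
    exact ⟨r, h1, h2, p, h3⟩
  · exact exists_fast_run hΔ hE I hp fun q hq => (hv p hp).trans (hv q hq).symm |>.le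

end TwoStep

theorem resilient [LinearOrder V] [WellFoundedLT V] (hef : e ≤ f) (hf : 2 * f + 1 ≤ n)
    (he : 2 * e + f ≤ n) : (gossip (V := V) n e f Δ).Resilient Δ f := fun _ hr =>
  ⟨validity hef hf, agreement hef hf he, termination (by omega) hr⟩

end Gossip

end TwoStepConsensus

theorem theorem1 {V : Type*} [Nontrivial V] (n e f Δ : ℕ)
    (hn : 3 ≤ n) (hef : e ≤ f) (hΔ : 0 < Δ) :
    (∃ P : TwoStepConsensus.Protocol n V, P.Resilient Δ f ∧ P.TwoStep Δ e) ↔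
      max (2 * e + f) (2 * f + 1) ≤ n := by
  rw [max_le_iff]
  constructor
  · rintro ⟨P, hP, hT⟩
    have hf := hP.two_mul_lt hΔ (by omega)
    exact ⟨hP.two_mul_add_le hΔ hT hef hf, hf⟩
  · rintro ⟨he, hf⟩
    -- The order on values is only a tie-breaking device for the protocol; any well-order of `V`
    -- will do.
    obtain ⟨_, _⟩ := exists_wellFoundedLT (α := V)
    exact ⟨TwoStepConsensus.gossip n e f Δ, TwoStepConsensus.Gossip.resilient hef hf he,
      TwoStepConsensus.Gossip.twoStep hΔ (by omega)⟩
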